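/- Let $d\ge 1$, $X=\mathbb R^d$ with Lebesgue measure $dx$, and $\mathbb R_+=(0,\infty)$. Let $\mathbb K(X)$ be the cone of discrete Radon measures $\eta=\sum_{x\in\tau(\eta)}s_x\delta_x$ on $X$ (finite on compact sets, $\tau(\eta)\subset X$ at most countable, $s_x=\eta(\{x\})>0$), with the trace of the Borel $\sigma$-algebra of the vague topology on Radon measures. Let $l:X\times\mathbb R_+\to\mathbb R$ be measurable with $l(x,s)>0$ for all $(x,s)\in X\times\mathbb R_+$, and let $$dm(x,s)=\frac{l(x,s)}{s}\,dx\,ds .$$ Assume that for every bounded Borel set $\Lambda\subset X$ $$\int_{\Lambda\times\mathbb R_+} l(x,s)\min\{s^{-1},1\}\,dx\,ds<\infty\qquad\text{and}\qquad m(\Lambda\times\mathbb R_+)<\infty .$$ There is a unique completely random probability measure $\mu_m$ on $\mathbb K(X)$ (that is, $\eta(A_1),\dots,\eta(A_n)$ are independent under $\mu_m$ for pairwise disjoint bounded Borel sets $A_1,\dots,A_n$) with $$\int_{\mathbb K(X)}e^{i\int_X f\,d\eta}\,d\mu_m(\eta)=\exp\Big[\int_X\int_{\mathbb R_+}\big(e^{isf(x)}-1\big)\,dm(x,s)\Big]$$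 for all continuous $f:X\to\mathbb R$ with compact support. Let $\mathfrak G$ be the semidirect product of the group $\mathrm{Diff}_0(X)$ of $C^\infty$ diffeomorphisms $\varphi$ of $X$ equal to the identity outside a compact set and the multiplicative group $C_0(X\to\mathbb R_+)$ of continuous functions $\theta:X\to\mathbb R_+$ equal to $1$ outside a compact set, with product $$(\varphi_1,\theta_1)(\varphi_2,\theta_2)=(\varphi_1\circ\varphi_2,\ \theta_1\cdot(\theta_2\circ\varphi_1^{-1})).$$ It acts on $\mathbb K(X)$ by $d(g\eta)=\theta\,d(\varphi^*\eta)$ for $g=(\varphi,\theta)$, where $\varphi^*\eta$ is the image of $\eta$ under $\varphi$. Write $\mu_m^g$ for the image of $\mu_m$ under $\eta\mapsto g\eta$, $\theta^{-1}=1/\theta$, and $J_\varphi(x)=|\det D(\varphi^{-1})(x)|$ (the density of the image of Lebesgue measure under $\varphi$). Then $\mu_m$ is quasi-invariant under $\mathfrak G$: for every $g\in\mathfrak G$ the measures $\mu_m^g$ and $\mu_m$ are equivalent (mutually absolutely continuous). Moreover, for every $g=(\varphi,\theta)\in\mathfrak G$ and $\mu_m$-a.e. $\eta$, $$\frac{d\mu_m^g}{d\mu_m}(\eta)=\Bigg(\prod_{x\in\tau(\eta)}\frac{l(\varphi^{-1}(x),\theta^{-1}(x)s_x)}{l(x,\theta^{-1}(x)s_x)}\,J_\varphi(x)\Bigg)\exp\Bigg[\int_X\log\Big(\frac{l(x,\theta^{-1}(x)s_x)}{l(x,s_x)}\Big)s_x^{-1}\,d\eta(x)+\int_X\int_{\mathbb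 R_+}\frac{l(x,s)-l(x,\theta^{-1}(x)s)}{s}\,ds\,dx\Bigg].$$ Here, for $\mu_m$-a.e. $\eta$, the product converges unconditionally and the function integrated against $\eta$ is $\eta$-integrable, and $(x,s)\mapsto\big(l(x,s)-l(x,\theta^{-1}(x)s)\big)/s$ is integrable on $X\times\mathbb R_+$. -/

import Mathlib

open MeasureTheory Set
open scoped ENNReal

/-- The underlying space `X = ℝ^d`, with its Euclidean structure. -/
abbrev RSpace (d : ℕ) : Type := EuclideanSpace ℝ (Fin d)

/-! ### The cone of discrete Radon measures -/

/-- `η` is a discrete Radon measure on `ℝ^d`: it is finite on compact sets and has the form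
`∑_{x ∈ τ} s_x δ_x` with `τ` at most countable and weights `s_x > 0` (`τ = ∅` gives `η = 0`). -/
def IsDiscreteRadon {d : ℕ} (η : Measure (RSpace d)) : Prop :=
  IsFiniteMeasureOnCompacts η ∧
    ∃ (τ : Set (RSpace d)) (s : RSpace d → ℝ), τ.Countable ∧ (∀ x ∈ τ, 0 < s x) ∧
      η = Measure.sum fun x : τ => ENNReal.ofReal (s x) • Measure.dirac (x : RSpace d)

/-- The cone `𝕂(ℝ^d)` of discrete Radon measures. Its σ-algebra is the trace of the σ-algebra
generated by the evaluations `η ↦ η A`; as `ℝ^d` is a countable union of compact sets, bounded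
Borel sets `A` generate the same σ-algebra, which is the Borel σ-algebra of the vague topology. -/
abbrev DiscreteRadonMeasure (d : ℕ) : Type := {η : Measure (RSpace d) // IsDiscreteRadon η}

/-- The weight `s_x = η({x})`. -/
noncomputable def DiscreteRadonMeasure.weight {d : ℕ} (η : DiscreteRadonMeasure d)
    (x : RSpace d) : ℝ := η.1.real {x}

/-- The set of atoms `τ(η)`. -/
def DiscreteRadonMeasure.atoms {d : ℕ} (η : DiscreteRadonMeasure d) : Set (RSpace d) :=
  {x | 0 < η.1 {x}}

theorem IsDiscreteRadon.exists_countable {d : ℕ} {η : Measure (RSpace d)}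
    (h : IsDiscreteRadon η) : ∃ τ : Set (RSpace d), τ.Countable ∧ η τᶜ = 0 := by
  obtain ⟨-, τ, s, hτ, -, rfl⟩ := h
  refine ⟨τ, hτ, ?_⟩
  rw [Measure.sum_apply _ hτ.measurableSet.compl]
  simp [hτ.measurableSet]

theorem IsDiscreteRadon.of_countable {d : ℕ} {η : Measure (RSpace d)}
    (hη : IsFiniteMeasureOnCompacts η) {S : Set (RSpace d)} (hS : S.Countable)
    (h0 : η Sᶜ = 0) : IsDiscreteRadon η := by
  have hfin : ∀ x, η {x} ≠ ∞ := fun x => (isCompact_singleton.measure_lt_top (μ := η)).ne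
  refine ⟨hη, {x ∈ S | η {x} ≠ 0}, fun x => (η {x}).toReal, hS.mono (sep_subset _ _),
    fun x hx => ENNReal.toReal_pos hx.2 (hfin x), ?_⟩
  set T : Set (RSpace d) := {x ∈ S | η {x} ≠ 0} with hT
  have hTc : T.Countable := hS.mono (sep_subset _ _)
  have hT0 : η Tᶜ = 0 := by
    have hsub : Tᶜ ⊆ Sᶜ ∪ ⋃ x ∈ {x ∈ S | η {x} = 0}, {x} := by
      intro x hx
      by_cases hxS : x ∈ S
      · right
        simp only [mem_iUnion, mem_singleton_iff]
        refine ⟨x, ⟨hxS, ?_⟩, rfl⟩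
        by_contra hne
        exact hx ⟨hxS, hne⟩
      · exact Or.inl hxS
    refine measure_mono_null hsub (measure_union_null h0 ?_)
    rw [measure_biUnion_null_iff (hS.mono (sep_subset _ _))]
    exact fun x hx => hx.2
  ext A hA
  rw [Measure.sum_apply _ hA]
  have : Countable T := hTc.to_subtype
  have h1 : η A = η (⋃ x : T, ({(x : RSpace d)} ∩ A)) := by
    rw [← iUnion_inter, iUnion_coe_set, biUnion_of_singleton, inter_comm]
    exact (measure_inter_conull hT0).symm
  rw [h1, measure_iUnion]
  · refine tsum_congr fun x => ?_
    rw [ENNReal.ofReal_toReal (hfin x), Measure.smul_apply, Measure.dirac_apply' _ hA]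
    by_cases hx : (x : RSpace d) ∈ A
    · rw [inter_eq_left.2 (singleton_subset_iff.2 hx)]
      simp [hx]
    · rw [singleton_inter_eq_empty.2 hx]
      simp [hx]
  · intro x y hxy
    exact Disjoint.mono inter_subset_left inter_subset_left
      (disjoint_singleton.2 fun h => hxy (Subtype.ext h))
  · exact fun x => (measurableSet_singleton _).inter hA

/-! ### The groups -/

/-- The group `Diff₀(ℝ^d)` of smooth diffeomorphisms of `ℝ^d` that are the identity outside a
compact set, under composition. -/
def Diff0 (d : ℕ) : Subgroup (Equiv.Perm (RSpace d)) where
  carrier := {φ | ContDiff ℝ ((⊤ : ℕ∞) : WithTop ℕ∞) φ ∧ ContDiff ℝ ((⊤ : ℕ∞) : WithTop ℕ∞) φ.symm ∧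
    ∃ K : Set (RSpace d), IsCompact K ∧ ∀ x ∉ K, φ x = x}
  one_mem' := ⟨contDiff_id, contDiff_id, ∅, isCompact_empty, fun _ _ => rfl⟩
  mul_mem' := by
    rintro φ ψ ⟨h1, h2, K, hK, h3⟩ ⟨h1', h2', K', hK', h3'⟩
    refine ⟨h1.comp h1', h2'.comp h2, K ∪ K', hK.union hK', fun x hx => ?_⟩
    rw [mem_union, not_or] at hx
    rw [Equiv.Perm.mul_apply, h3' x hx.2, h3 x hx.1]
  inv_mem' := by
    rintro φ ⟨h1, h2, K, hK, h3⟩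
    refine ⟨h2, h1, K, hK, fun x hx => ?_⟩
    rw [Equiv.Perm.inv_eq_iff_eq, h3 x hx]

/-- The current group `C₀(ℝ^d → ℝ₊)` of continuous functions with values in `(0,∞)` that are equal
to `1` outside a compact set, under pointwise multiplication. -/
def CurrentGroup (d : ℕ) : Subgroup (RSpace d → {r : ℝ // 0 < r}) where
  carrier := {θ | Continuous (fun x => (θ x : ℝ)) ∧
    ∃ K : Set (RSpace d), IsCompact K ∧ ∀ x ∉ K, θ x = 1}
  one_mem' := ⟨continuous_const, ∅, isCompact_empty, fun _ _ => rfl⟩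
  mul_mem' := by
    rintro θ ρ ⟨h1, K, hK, h3⟩ ⟨h1', K', hK', h3'⟩
    refine ⟨h1.mul h1', K ∪ K', hK.union hK', fun x hx => ?_⟩
    rw [mem_union, not_or] at hx
    rw [Pi.mul_apply, h3 x hx.1, h3' x hx.2, one_mul]
  inv_mem' := by
    rintro θ ⟨h1, K, hK, h3⟩
    refine ⟨h1.inv₀ fun x => (θ x).2.ne', K, hK, fun x hx => ?_⟩
    rw [Pi.inv_apply, h3 x hx, inv_one]

theorem diff0_continuous {d : ℕ} (φ : Diff0 d) : Continuous (φ : Equiv.Perm (RSpace d)) :=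
  φ.2.1.continuous

theorem diff0_continuous_symm {d : ℕ} (φ : Diff0 d) :
    Continuous (φ : Equiv.Perm (RSpace d)).symm :=
  φ.2.2.1.continuous

theorem currentGroup_continuous {d : ℕ} (θ : CurrentGroup d) :
    Continuous fun x => (θ.1 x : ℝ) :=
  θ.2.1

/-- `θ ∘ φ⁻¹` belongs to the current group. -/
def currentComp {d : ℕ} (φ : Diff0 d) (θ : CurrentGroup d) : CurrentGroup d :=
  ⟨fun x => θ.1 ((φ : Equiv.Perm (RSpace d)).symm x), by
    obtain ⟨K, hK, h⟩ := θ.2.2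
    refine ⟨(currentGroup_continuous θ).comp (diff0_continuous_symm φ), (φ : Equiv.Perm (RSpace d)) '' K,
      hK.image (diff0_continuous φ), fun x hx => h _ fun hx' => hx ⟨_, hx', ?_⟩⟩
    simp⟩

/-- The action of `Diff₀(ℝ^d)` on the current group by the automorphisms `θ ↦ θ ∘ φ⁻¹`. -/
def currentAut (d : ℕ) : Diff0 d →* MulAut (CurrentGroup d) where
  toFun φ :=
    { toFun := currentComp φ
      invFun := currentComp φ⁻¹
      left_inv := fun θ => Subtype.ext <| funext fun x =>
        congrArg θ.1 ((φ : Equiv.Perm (RSpace d)).symm_apply_apply x)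
      right_inv := fun θ => Subtype.ext <| funext fun x =>
        congrArg θ.1 ((φ : Equiv.Perm (RSpace d)).apply_symm_apply x)
      map_mul' := fun _ _ => rfl }
  map_one' := rfl
  map_mul' := fun _ _ => rfl

/-- The semidirect product `𝔊` of `Diff₀(ℝ^d)` and the current group. An element `g = (φ, θ)` has
`g.right = φ` and `g.left = θ`, and
`(φ₁, θ₁) (φ₂, θ₂) = (φ₁ ∘ φ₂, θ₁ · (θ₂ ∘ φ₁⁻¹))`. -/
abbrev SemidirectGroup (d : ℕ) : Type := CurrentGroup d ⋊[currentAut d] Diff0 d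

namespace SemidirectGroup

/-- The diffeomorphism `φ` of `g = (φ, θ)`. -/
def diffeo {d : ℕ} (g : SemidirectGroup d) : Equiv.Perm (RSpace d) := g.right

/-- The function `θ` of `g = (φ, θ)`. -/
def current {d : ℕ} (g : SemidirectGroup d) (x : RSpace d) : ℝ := g.left.1 x

/-- `J_φ(x) = |det D(φ⁻¹)(x)|`, the density of the image of Lebesgue measure under `φ`. -/
noncomputable def jacobian {d : ℕ} (g : SemidirectGroup d) (x : RSpace d) : ℝ :=
  |(fderiv ℝ g.diffeo.symm x).det|

/-- The action of `g = (φ, θ)` on measures: `d(gη)(x) = θ(x) d(φ^*η)(x)`, where `φ^*η` is the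
image of `η` under `φ`. -/
noncomputable def actMeasure {d : ℕ} (g : SemidirectGroup d) (η : Measure (RSpace d)) :
    Measure (RSpace d) :=
  (η.map g.diffeo).withDensity fun x => ENNReal.ofReal (g.current x)

theorem measurable_diffeo {d : ℕ} (g : SemidirectGroup d) : Measurable g.diffeo :=
  (diff0_continuous g.right).measurable

theorem continuous_current {d : ℕ} (g : SemidirectGroup d) : Continuous g.current :=
  currentGroup_continuous g.left

theorem measurable_ofReal_current {d : ℕ} (g : SemidirectGroup d) :
    Measurable fun x => ENNReal.ofReal (g.current x) :=
  g.continuous_current.measurable.ennreal_ofReal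

theorem actMeasure_apply {d : ℕ} (g : SemidirectGroup d) (η : Measure (RSpace d))
    {A : Set (RSpace d)} (hA : MeasurableSet A) :
    g.actMeasure η A =
      ∫⁻ x in g.diffeo ⁻¹' A, ENNReal.ofReal (g.current (g.diffeo x)) ∂η := by
  rw [actMeasure, withDensity_apply _ hA,
    setLIntegral_map hA g.measurable_ofReal_current g.measurable_diffeo]

theorem isDiscreteRadon_actMeasure {d : ℕ} (g : SemidirectGroup d) {η : Measure (RSpace d)}
    (hη : IsDiscreteRadon η) : IsDiscreteRadon (g.actMeasure η) := by
  have hfin : IsFiniteMeasureOnCompacts η := hη.1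
  obtain ⟨τ, hτ, h0⟩ := hη.exists_countable
  refine IsDiscreteRadon.of_countable ⟨fun K hK => ?_⟩ (hτ.image g.diffeo) ?_
  · rw [actMeasure_apply _ _ hK.measurableSet]
    have hK' : IsCompact (g.diffeo ⁻¹' K) := by
      rw [← Equiv.image_symm_eq_preimage]
      exact hK.image (diff0_continuous_symm g.right)
    have hc : Continuous fun x => Real.toNNReal (g.current (g.diffeo x)) :=
      continuous_real_toNNReal.comp (g.continuous_current.comp (diff0_continuous g.right))
    exact setLIntegral_lt_top_of_isCompact hK'.measure_lt_top.ne hK' hc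
  · rw [actMeasure_apply _ _ (hτ.image _).measurableSet.compl]
    refine setLIntegral_measure_zero _ _ ?_
    rwa [preimage_compl, preimage_image_eq _ g.diffeo.injective]

theorem actMeasure_one {d : ℕ} (η : Measure (RSpace d)) :
    (1 : SemidirectGroup d).actMeasure η = η := by
  ext A hA
  rw [actMeasure_apply _ _ hA]
  have h1 : (1 : SemidirectGroup d).diffeo = 1 := rfl
  have h2 : ∀ x, (1 : SemidirectGroup d).current x = 1 := fun x => rfl
  simp [h1, h2]

theorem actMeasure_mul {d : ℕ} (g h : SemidirectGroup d) (η : Measure (RSpace d)) :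
    (g * h).actMeasure η = g.actMeasure (h.actMeasure η) := by
  ext A hA
  have hA' : MeasurableSet (g.diffeo ⁻¹' A) := g.measurable_diffeo hA
  have hcomp : Measurable fun x => ENNReal.ofReal (g.current (g.diffeo x)) :=
    g.measurable_ofReal_current.comp g.measurable_diffeo
  rw [actMeasure_apply _ _ hA, actMeasure_apply _ _ hA, actMeasure,
    setLIntegral_withDensity_eq_setLIntegral_mul _ h.measurable_ofReal_current hcomp hA',
    setLIntegral_map hA' (h.measurable_ofReal_current.mul hcomp) h.measurable_diffeo]
  refine lintegral_congr fun x => ?_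
  have h1 : (g * h).diffeo x = g.diffeo (h.diffeo x) := rfl
  have h2 : ∀ y, (g * h).current y = g.current y * h.current (g.diffeo.symm y) := fun y => rfl
  have h3 : 0 ≤ g.current (g.diffeo (h.diffeo x)) := (g.left.1 _).2.le
  simp only [Pi.mul_apply]
  rw [h1, h2, Equiv.symm_apply_apply, ENNReal.ofReal_mul h3, mul_comm]

/-- The action of `𝔊` on the cone of discrete Radon measures. -/
noncomputable instance instMulAction (d : ℕ) :
    MulAction (SemidirectGroup d) (DiscreteRadonMeasure d) where
  smul g η := ⟨g.actMeasure η.1, g.isDiscreteRadon_actMeasure η.2⟩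
  one_smul η := Subtype.ext (actMeasure_one η.1)
  mul_smul g h η := Subtype.ext (actMeasure_mul g h η.1)

end SemidirectGroup

/-! ### Quasi-invariance -/

/-- `μ` is quasi-invariant under the action of the group `G`: for every `g`, the image of `μ` under
`g` is equivalent to `μ`. -/
def IsQuasiInvariant (G : Type*) {Ω : Type*} [Group G] [MulAction G Ω] [MeasurableSpace Ω]
    (μ : Measure Ω) : Prop :=
  ∀ g : G, Measurable (fun ω : Ω => g • ω) ∧
    μ.map (fun ω => g • ω) ≪ μ ∧ μ ≪ μ.map (fun ω => g • ω)

/-! ### Completely random measures -/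

/-- The measure `dm(x,s) = (l(x,s) / s) dx ds` on `ℝ^d × ℝ₊`, where `ℝ₊ = (0,∞)`, regarded as a
measure on `ℝ^d × ℝ` that does not charge `ℝ^d × (-∞,0]`. -/
noncomputable def levyMeasure {d : ℕ} (l : RSpace d → ℝ → ℝ) : Measure (RSpace d × ℝ) :=
  ((volume : Measure (RSpace d)).prod (volume.restrict (Ioi (0 : ℝ)))).withDensity
    fun p => ENNReal.ofReal (l p.1 p.2 / p.2)

/-- The random discrete measure with law `μ` is completely random: its values on finitely many
pairwise disjoint bounded Borel sets are independent. -/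
def IsCompletelyRandom {d : ℕ} (μ : Measure (DiscreteRadonMeasure d)) : Prop :=
  ∀ (n : ℕ) (A : Fin n → Set (RSpace d)), (∀ i, MeasurableSet (A i)) →
    (∀ i, Bornology.IsBounded (A i)) → Pairwise (fun i j => Disjoint (A i) (A j)) →
    ProbabilityTheory.iIndepFun (fun i (η : DiscreteRadonMeasure d) => η.1 (A i)) μ

/-- `μ` is the (law of the) completely random measure with Lévy measure `m`: a completely random
probability measure on `𝕂(ℝ^d)` whose Fourier transform at every continuous compactly supported
`f` is `exp (∫ (e^{i s f(x)} - 1) dm(x,s))`. -/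
structure IsCompletelyRandomWithLevyMeasure {d : ℕ} (m : Measure (RSpace d × ℝ))
    (μ : Measure (DiscreteRadonMeasure d)) : Prop where
  isProbabilityMeasure : IsProbabilityMeasure μ
  isCompletelyRandom : IsCompletelyRandom μ
  fourier : ∀ f : RSpace d → ℝ, Continuous f → HasCompactSupport f →
    ∫ η, Complex.exp (Complex.I * ((∫ x, f x ∂η.1 : ℝ) : ℂ)) ∂μ =
      Complex.exp (∫ p, (Complex.exp (Complex.I * ((p.2 * f p.1 : ℝ) : ℂ)) - 1) ∂m)

/-! ### The Radon–Nikodym density -/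

/-- The factor of the product over the atoms, at the atom `x` of `η`:
`l(φ⁻¹(x), θ⁻¹(x) s_x) / l(x, θ⁻¹(x) s_x) · J_φ(x)`, where `θ⁻¹ = 1/θ`. -/
noncomputable def atomFactor {d : ℕ} (l : RSpace d → ℝ → ℝ) (g : SemidirectGroup d)
    (η : DiscreteRadonMeasure d) (x : RSpace d) : ℝ :=
  l (g.diffeo.symm x) ((g.current x)⁻¹ * η.weight x) / l x ((g.current x)⁻¹ * η.weight x) *
    g.jacobian x

/-- The integrand `log (l(x, θ⁻¹(x) s_x) / l(x, s_x)) · s_x⁻¹` of the integral against `η`. -/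
noncomputable def logIntegrand {d : ℕ} (l : RSpace d → ℝ → ℝ) (g : SemidirectGroup d)
    (η : DiscreteRadonMeasure d) (x : RSpace d) : ℝ :=
  Real.log (l x ((g.current x)⁻¹ * η.weight x) / l x (η.weight x)) * (η.weight x)⁻¹

/-- The integrand `(l(x,s) - l(x, θ⁻¹(x) s)) / s` of the deterministic term. -/
noncomputable def compensator {d : ℕ} (l : RSpace d → ℝ → ℝ) (g : SemidirectGroup d)
    (x : RSpace d) (s : ℝ) : ℝ :=
  (l x s - l x ((g.current x)⁻¹ * s)) / s

/-- The density of the image of the completely random measure under `g = (φ, θ)`. -/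
noncomputable def semidirectDensity {d : ℕ} (l : RSpace d → ℝ → ℝ) (g : SemidirectGroup d)
    (η : DiscreteRadonMeasure d) : ℝ :=
  (∏' x : η.atoms, atomFactor l g η x) *
    Real.exp ((∫ x, logIntegrand l g η x ∂η.1) +
      ∫ x, ∫ s in Ioi (0 : ℝ), compensator l g x s)

open Filter ProbabilityTheory
open scoped Topology CompactlySupported

namespace DiscreteRadonMeasure

variable {d : ℕ}

theorem isFiniteMeasureOnCompacts (η : DiscreteRadonMeasure d) :
    IsFiniteMeasureOnCompacts η.1 := η.2.1

theorem measure_lt_top_of_isBounded (η : DiscreteRadonMeasure d) {A : Set (RSpace d)}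
    (hA : Bornology.IsBounded A) : η.1 A < ∞ := by
  have := η.isFiniteMeasureOnCompacts
  exact (measure_mono subset_closure).trans_lt hA.isCompact_closure.measure_lt_top

end DiscreteRadonMeasure

/-- The annulus `k ≤ ‖x‖ < k + 1`. -/
def annulus (d k : ℕ) : Set (RSpace d) := {x | ⌊‖x‖⌋₊ = k}

theorem measurableSet_annulus (d k : ℕ) : MeasurableSet (annulus d k) :=
  (Nat.measurable_floor.comp measurable_norm) (measurableSet_singleton k)

theorem annulus_subset_ball (d k : ℕ) : annulus d k ⊆ Metric.ball 0 (k + 1) := by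
  intro x hx
  have h : ⌊‖x‖⌋₊ = k := hx
  rw [mem_ball_zero_iff, ← h]
  exact Nat.lt_floor_add_one _

theorem isBounded_annulus (d k : ℕ) : Bornology.IsBounded (annulus d k) :=
  Metric.isBounded_ball.subset (annulus_subset_ball d k)

theorem pairwise_disjoint_annulus (d : ℕ) : Pairwise (Function.onFun Disjoint (annulus d)) := by
  intro i j hij
  exact Set.disjoint_left.2 fun x (hx : ⌊‖x‖⌋₊ = i) (hx' : ⌊‖x‖⌋₊ = j) => hij (hx ▸ hx')

theorem iUnion_annulus (d : ℕ) : ⋃ k, annulus d k = univ :=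
  eq_univ_of_forall fun x => mem_iUnion.2 ⟨⌊‖x‖⌋₊, rfl⟩

theorem mem_ball_iff_of_mem_annulus {d k n : ℕ} {x : RSpace d} (hx : x ∈ annulus d k) :
    x ∈ Metric.ball (0 : RSpace d) n ↔ k < n := by
  have h : ⌊‖x‖⌋₊ = k := hx
  rw [mem_ball_zero_iff, ← h, Nat.floor_lt (norm_nonneg x)]

theorem iUnion_annulus_lt (d n : ℕ) :
    ⋃ k ∈ Finset.range n, annulus d k = Metric.ball (0 : RSpace d) n := by
  ext x
  simp only [mem_iUnion, Finset.mem_range, exists_prop]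
  constructor
  · rintro ⟨k, hk, hx⟩
    exact (mem_ball_iff_of_mem_annulus hx).2 hk
  · intro hx
    exact ⟨⌊‖x‖⌋₊, (mem_ball_iff_of_mem_annulus rfl).1 hx, rfl⟩

namespace DiscreteRadonMeasure

variable {d : ℕ}

/-- The tautological kernel `η ↦ η`. -/
noncomputable def kernel (d : ℕ) : Kernel (DiscreteRadonMeasure d) (RSpace d) :=
  ⟨Subtype.val, measurable_subtype_coe⟩

@[simp]
theorem kernel_apply (η : DiscreteRadonMeasure d) : kernel d η = η.1 := rfl

theorem measurable_eval {A : Set (RSpace d)} (hA : MeasurableSet A) :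
    Measurable fun η : DiscreteRadonMeasure d => η.1 A :=
  (Measure.measurable_coe hA).comp measurable_subtype_coe

open Classical in
instance : IsSFiniteKernel (kernel d) := by
  have hms : ∀ p : ℕ × ℕ, MeasurableSet
      {η : DiscreteRadonMeasure d | ⌊(η.1 (annulus d p.1)).toNNReal⌋₊ = p.2} := fun p =>
    (Nat.measurable_floor.comp (measurable_eval (measurableSet_annulus d p.1)).ennreal_toNNReal)
      (measurableSet_singleton p.2)
  let κ : ℕ × ℕ → Kernel (DiscreteRadonMeasure d) (RSpace d) := fun p =>
    Kernel.piecewise (hms p) ((kernel d).restrict (measurableSet_annulus d p.1)) 0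
  have hκ : ∀ p, IsFiniteKernel (κ p) := by
    refine fun p => ⟨(p.2 + 1 : ℕ), by simp, fun η => ?_⟩
    simp only [κ, Kernel.piecewise_apply]
    split_ifs with h
    · simp only [Kernel.restrict_apply, kernel_apply, Measure.restrict_apply MeasurableSet.univ,
        univ_inter]
      rw [← ENNReal.coe_toNNReal (η.measure_lt_top_of_isBounded (isBounded_annulus d p.1)).ne]
      have h' : ⌊(η.1 (annulus d p.1)).toNNReal⌋₊ = p.2 := h
      have := (Nat.lt_floor_add_one (η.1 (annulus d p.1)).toNNReal).le
      rw [h'] at this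
      exact_mod_cast this
    · simp
  have : kernel d = Kernel.sum κ := by
    ext η A hA
    rw [Kernel.sum_apply' _ _ hA, ENNReal.tsum_prod (f := fun k j => κ (k, j) η A), kernel_apply]
    have h1 : ∀ k, ∑' j, κ (k, j) η A = η.1 (A ∩ annulus d k) := by
      intro k
      rw [tsum_eq_single ⌊(η.1 (annulus d k)).toNNReal⌋₊]
      · simp only [κ, Kernel.piecewise_apply, mem_ofPred_eq]
        rw [if_pos trivial, Kernel.restrict_apply, kernel_apply, Measure.restrict_apply hA]
      · intro j hj
        simp only [κ, Kernel.piecewise_apply, mem_ofPred_eq]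
        rw [if_neg (fun h => hj (Eq.symm h))]
        simp
    simp_rw [h1]
    rw [← measure_iUnion, ← inter_iUnion, iUnion_annulus, inter_univ]
    · exact fun i j hij => (pairwise_disjoint_annulus d hij).mono inter_subset_right
        inter_subset_right
    · exact fun k => hA.inter (measurableSet_annulus d k)
  rw [this]
  infer_instance

theorem measurable_measure_singleton :
    Measurable fun p : DiscreteRadonMeasure d × RSpace d => p.1.1 {p.2} := by
  have h : MeasurableSet {q : (DiscreteRadonMeasure d × RSpace d) × RSpace d | q.2 = q.1.2} :=
    measurableSet_eq_fun measurable_snd measurable_fst.snd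
  have := Kernel.measurable_kernel_prodMk_left (κ := (kernel d).prodMkRight (RSpace d)) h
  convert this using 1
  funext p
  exact congrArg p.1.1 (Set.ext fun y => Iff.rfl)

theorem measurable_weight :
    Measurable fun p : DiscreteRadonMeasure d × RSpace d => p.1.weight p.2 :=
  measurable_measure_singleton.ennreal_toReal

theorem stronglyMeasurable_integral {f : DiscreteRadonMeasure d → RSpace d → ℝ}
    (hf : Measurable (Function.uncurry f)) :
    StronglyMeasurable fun η : DiscreteRadonMeasure d => ∫ x, f η x ∂η.1 :=
  StronglyMeasurable.integral_kernel_prod_right (κ := kernel d) hf.stronglyMeasurable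

theorem measurable_integral {f : RSpace d → ℝ} (hf : Measurable f) :
    Measurable fun η : DiscreteRadonMeasure d => ∫ x, f x ∂η.1 :=
  (stronglyMeasurable_integral (f := fun _ x => f x) (hf.comp measurable_snd)).measurable

/-- Measurability of a random discrete measure can be tested on compactly supported continuous
functions. -/
theorem measurable_of_measurable_integral {Ω : Type*} [MeasurableSpace Ω]
    {F : Ω → DiscreteRadonMeasure d}
    (hF : ∀ f : C_c(RSpace d, ℝ), Measurable fun ω => ∫ x, f x ∂(F ω).1) : Measurable F := by
  have hK : ∀ K : Set (RSpace d), IsCompact K → Measurable fun ω => (F ω).1 K := by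
    intro K hK
    have hδ : ∀ m : ℕ, (0 : ℝ) < 1 / ((m : ℝ) + 1) := fun m => Nat.one_div_pos_of_nat
    have hδ' : ∀ m : ℕ, 1 / ((m : ℝ) + 1) ≤ 1 := fun m => by
      rw [div_le_one (by positivity)]
      have : (0 : ℝ) ≤ m := Nat.cast_nonneg m
      linarith
    have hδlim : Tendsto (fun m : ℕ => 1 / ((m : ℝ) + 1)) atTop (𝓝 0) :=
      tendsto_one_div_add_atTop_nhds_zero_nat
    set L := Metric.cthickening 1 K
    have hLc : IsCompact L := hK.cthickening
    have hsupp : ∀ m x, x ∉ L → thickenedIndicator (hδ m) K x = 0 := fun m x hx =>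
      thickenedIndicator_zero _ _ fun hx' => hx
        ((Metric.thickening_subset_cthickening _ _).trans
          (Metric.cthickening_mono (hδ' m) K) hx')
    refine measurable_of_tendsto_metrizable
      (f := fun (m : ℕ) ω => ∫⁻ x, (thickenedIndicator (hδ m) K x : ℝ≥0∞) ∂(F ω).1) ?_ ?_
    · intro m
      let f : C_c(RSpace d, ℝ) :=
        { toFun := fun x => (thickenedIndicator (hδ m) K x : ℝ)
          continuous_toFun := NNReal.continuous_coe.comp (thickenedIndicator (hδ m) K).continuous
          hasCompactSupport' := HasCompactSupport.intro hLc fun x hx => by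
            rw [hsupp m x hx, NNReal.coe_zero] }
      have : ∀ ω, ∫⁻ x, (thickenedIndicator (hδ m) K x : ℝ≥0∞) ∂(F ω).1
          = ENNReal.ofReal (∫ x, f x ∂(F ω).1) := by
        intro ω
        have := (F ω).isFiniteMeasureOnCompacts
        rw [ofReal_integral_eq_lintegral_ofReal
          (f := fun x => f x) (f.continuous.integrable_of_hasCompactSupport f.hasCompactSupport)
          (Eventually.of_forall fun x => NNReal.coe_nonneg _)]
        refine lintegral_congr fun x => ?_
        exact (ENNReal.ofReal_coe_nnreal).symm
      simp_rw [this]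
      exact (hF f).ennreal_ofReal
    · rw [tendsto_pi_nhds]
      intro ω
      have := (F ω).isFiniteMeasureOnCompacts
      have hfin : IsFiniteMeasure ((F ω).1.restrict L) := ⟨by
        simpa using hLc.measure_lt_top⟩
      have h := tendsto_lintegral_thickenedIndicator_of_isClosed ((F ω).1.restrict L)
        hK.isClosed hδ hδlim
      rw [Measure.restrict_apply hK.measurableSet,
        inter_eq_left.2 (Metric.self_subset_cthickening K)] at h
      refine h.congr fun m => ?_
      rw [← lintegral_indicator hLc.measurableSet]
      refine lintegral_congr fun x => ?_
      by_cases hx : x ∈ L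
      · rw [indicator_of_mem hx]
      · rw [indicator_of_notMem hx, hsupp m x hx, ENNReal.coe_zero]
  refine Measurable.subtype_mk (f := fun ω => (F ω).1) ?_
  refine Measure.measurable_of_measurable_coe _ fun A hA => ?_
  have hA' : ∀ ω, (F ω).1 A =
      ⨆ n : ℕ, (F ω).1.restrict (Metric.closedBall 0 n) A := by
    intro ω
    simp_rw [Measure.restrict_apply hA]
    rw [← Monotone.measure_iUnion, ← inter_iUnion, Metric.iUnion_closedBall_nat, inter_univ]
    exact fun i j hij => inter_subset_inter_right _
      (Metric.closedBall_subset_closedBall (by exact_mod_cast hij))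
  simp_rw [hA']
  refine Measurable.iSup fun n => (Measure.measurable_coe hA).comp ?_
  have hfin : ∀ ω, IsFiniteMeasure ((F ω).1.restrict (Metric.closedBall 0 n)) := fun ω => ⟨by
    simpa using (F ω).measure_lt_top_of_isBounded Metric.isBounded_closedBall⟩
  refine Measurable.measure_of_isPiSystem (S := {s | IsClosed s}) ?_ isPiSystem_isClosed ?_ ?_
  · rw [← borel_eq_generateFrom_isClosed]
    exact BorelSpace.measurable_eq
  · intro s hs
    have hs' : IsClosed s := hs
    simp_rw [Measure.restrict_apply hs'.measurableSet]
    exact hK _ ((isCompact_closedBall _ _).inter_left hs')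
  · simp only [Measure.restrict_apply MeasurableSet.univ, univ_inter]
    exact hK _ (isCompact_closedBall _ _)

/-- A finite measure on the cone of discrete Radon measures is determined by its Fourier
transform. -/
theorem ext_of_fourier {μ ν : Measure (DiscreteRadonMeasure d)} [IsFiniteMeasure μ]
    [IsFiniteMeasure ν]
    (h : ∀ f : RSpace d → ℝ, Continuous f → HasCompactSupport f →
      ∫ η, Complex.exp (Complex.I * ((∫ x, f x ∂η.1 : ℝ) : ℂ)) ∂μ =
        ∫ η, Complex.exp (Complex.I * ((∫ x, f x ∂η.1 : ℝ) : ℂ)) ∂ν) : μ = ν := by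
  classical
  let Ψ : DiscreteRadonMeasure d → (C_c(RSpace d, ℝ) → ℝ) := fun η f => ∫ x, f x ∂η.1
  have hΨ : Measurable Ψ :=
    measurable_pi_lambda _ fun f => measurable_integral f.continuous.measurable
  have hle : (inferInstance : MeasurableSpace (DiscreteRadonMeasure d)) ≤
      MeasurableSpace.comap Ψ inferInstance := by
    have := @measurable_of_measurable_integral d (DiscreteRadonMeasure d)
      (MeasurableSpace.comap Ψ inferInstance) id fun f =>
        (measurable_pi_apply f).comp (comap_measurable Ψ)
    exact fun s hs => this hs
  have hmap : μ.map Ψ = ν.map Ψ := by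
    have := Measure.isFiniteMeasure_map μ Ψ
    have := Measure.isFiniteMeasure_map ν Ψ
    refine IsProjectiveLimit.unique (P := fun J => (μ.map Ψ).map J.restrict) (fun J => rfl)
      fun J => ?_
    have hJ : Measurable (J.restrict ∘ Ψ) := (Finset.measurable_restrict J).comp hΨ
    simp only
    rw [Measure.map_map (Finset.measurable_restrict J) hΨ,
      Measure.map_map (Finset.measurable_restrict J) hΨ]
    have := Measure.isFiniteMeasure_map μ (J.restrict ∘ Ψ)
    have := Measure.isFiniteMeasure_map ν (J.restrict ∘ Ψ)
    refine Measure.ext_of_charFunDual (funext fun L => ?_)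
    rw [charFunDual_apply, charFunDual_apply,
      integral_map hJ.aemeasurable (by fun_prop), integral_map hJ.aemeasurable (by fun_prop)]
    have key : ∀ η, L ((J.restrict ∘ Ψ) η) =
        ∫ x, (∑ j : J, L (Pi.single j 1) • (j : C_c(RSpace d, ℝ))) x ∂η.1 := by
      intro η
      have := η.isFiniteMeasureOnCompacts
      have h1 : L ((J.restrict ∘ Ψ) η) =
          ∑ j : J, (J.restrict (Ψ η)) j • L (Pi.single j 1) := by
        conv_lhs => rw [Function.comp_apply, ← Finset.univ_sum_single (J.restrict (Ψ η)), map_sum]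
        refine Finset.sum_congr rfl fun j _ => ?_
        rw [← map_smul, ← Pi.single_smul, smul_eq_mul, mul_one]
      have h2 : ∀ x, (∑ j : J, L (Pi.single j 1) • (j : C_c(RSpace d, ℝ))) x =
          ∑ j : J, L (Pi.single j 1) * (j : C_c(RSpace d, ℝ)) x := by
        intro x
        simp [CompactlySupportedContinuousMap.coe_sum]
      simp_rw [h1, h2]
      rw [integral_finsetSum]
      · refine Finset.sum_congr rfl fun j _ => ?_
        rw [integral_const_mul, smul_eq_mul, mul_comm]
        rfl
      · exact fun j _ => ((j : C_c(RSpace d, ℝ)).continuous.integrable_of_hasCompactSupport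
          (j : C_c(RSpace d, ℝ)).hasCompactSupport).const_mul _
    simp_rw [key, mul_comm _ Complex.I]
    exact (h _ (ContinuousMapClass.map_continuous _)
      (CompactlySupportedContinuousMap.hasCompactSupport _)).symm
  ext s hs
  obtain ⟨t, ht, rfl⟩ := hle s hs
  rw [← Measure.map_apply hΨ ht, hmap, Measure.map_apply hΨ ht]

end DiscreteRadonMeasure

namespace DiscreteRadonMeasure

variable {d : ℕ}

theorem measure_singleton_ne_top (η : DiscreteRadonMeasure d) (x : RSpace d) : η.1 {x} ≠ ∞ :=
  (η.measure_lt_top_of_isBounded Bornology.isBounded_singleton).ne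

theorem weight_pos {η : DiscreteRadonMeasure d} {x : RSpace d} (hx : x ∈ η.atoms) :
    0 < η.weight x :=
  ENNReal.toReal_pos (ne_of_gt hx) (η.measure_singleton_ne_top x)

theorem countable_atoms (η : DiscreteRadonMeasure d) : η.atoms.Countable := by
  obtain ⟨τ, hτ, h0⟩ := η.2.exists_countable
  refine hτ.mono fun x hx => ?_
  by_contra hxτ
  exact (ne_of_gt hx) (measure_mono_null (singleton_subset_iff.2 hxτ) h0)

theorem ae_mem_atoms (η : DiscreteRadonMeasure d) : ∀ᵐ x ∂η.1, x ∈ η.atoms := by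
  obtain ⟨τ, hτ, h0⟩ := η.2.exists_countable
  have h1 : η.1 {x ∈ τ | η.1 {x} = 0} = 0 := by
    rw [← biUnion_of_singleton {x ∈ τ | η.1 {x} = 0},
      measure_biUnion_null_iff (hτ.mono (sep_subset _ _))]
    exact fun x hx => hx.2
  refine measure_mono_null (fun x hx => ?_) (measure_union_null h0 h1)
  have hx0 : η.1 {x} = 0 := by
    by_contra hne
    exact hx (pos_iff_ne_zero.2 hne)
  by_cases hxτ : x ∈ τ
  · exact Or.inr ⟨hxτ, hx0⟩
  · exact Or.inl hxτ

/-- The discrete measures with finitely many atoms in every ball; the integral of the inverse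
weight over a set counts the atoms in that set. -/
def locallyFiniteAtoms (d : ℕ) : Set (DiscreteRadonMeasure d) :=
  {η | ∀ n : ℕ, ∫⁻ x in Metric.ball 0 n, (η.1 {x})⁻¹ ∂η.1 < ∞}

theorem measurableSet_locallyFiniteAtoms (d : ℕ) : MeasurableSet (locallyFiniteAtoms d) := by
  have h : locallyFiniteAtoms d = ⋂ n : ℕ, {η : DiscreteRadonMeasure d |
      ∫⁻ x in Metric.ball 0 n, (η.1 {x})⁻¹ ∂η.1 < ∞} := by
    ext η
    simp [locallyFiniteAtoms]
  rw [h]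
  refine MeasurableSet.iInter fun n => measurableSet_lt ?_ measurable_const
  have := Measurable.lintegral_kernel_prod_right
    (κ := (kernel d).restrict (Metric.isOpen_ball (x := (0 : RSpace d)) (ε := n)).measurableSet)
    (f := fun η x => (η.1 {x})⁻¹) measurable_measure_singleton.inv
  simpa only [Kernel.restrict_apply, kernel_apply] using this

theorem finite_atoms_inter_ball {η : DiscreteRadonMeasure d} (hη : η ∈ locallyFiniteAtoms d)
    (n : ℕ) : (η.atoms ∩ Metric.ball 0 n).Finite := by
  have hc : (η.atoms ∩ Metric.ball 0 n).Countable := η.countable_atoms.mono inter_subset_left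
  have h1 : ∑' x : (η.atoms ∩ Metric.ball 0 n : Set (RSpace d)), (1 : ℝ≥0∞) < ∞ := by
    refine lt_of_le_of_lt ?_ (hη n)
    refine le_trans (le_of_eq ?_) (lintegral_mono_set (inter_subset_right (s := η.atoms)))
    rw [lintegral_countable _ hc]
    refine tsum_congr fun x => ?_
    rw [ENNReal.inv_mul_cancel (ne_of_gt x.2.1) (η.measure_singleton_ne_top _)]
  have h2 := ENNReal.finite_const_le_of_tsum_ne_top h1.ne one_ne_zero
  simp only [le_refl] at h2
  have : Finite (η.atoms ∩ Metric.ball 0 n : Set (RSpace d)) := finite_univ_iff.1 h2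
  exact toFinite _

theorem integrable_and_integral_eq_sum {η : DiscreteRadonMeasure d}
    (hη : η ∈ locallyFiniteAtoms d) {n : ℕ} {f : RSpace d → ℝ}
    (hf : ∀ x ∉ Metric.ball (0 : RSpace d) n, f x = 0) :
    Integrable f η.1 ∧
      ∫ x, f x ∂η.1 = ∑ x ∈ (finite_atoms_inter_ball hη n).toFinset, η.weight x * f x := by
  set S := (finite_atoms_inter_ball hη n).toFinset
  have hS' : (S : Set (RSpace d)) = η.atoms ∩ Metric.ball 0 n := Finite.coe_toFinset _
  have h0 : ∀ᵐ x ∂η.1, x ∉ (S : Set (RSpace d)) → f x = 0 := by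
    filter_upwards [η.ae_mem_atoms] with x hx hxS
    exact hf x fun hx' => hxS (hS' ▸ ⟨hx, hx'⟩)
  have hint : IntegrableOn f S η.1 := by
    rw [← biUnion_of_singleton (S : Set (RSpace d))]
    exact (integrableOn_finite_biUnion S.finite_toSet).2 fun x _ =>
      integrableOn_singleton (by simp) (η.measure_singleton_ne_top x).lt_top
  refine ⟨hint.integrable_of_ae_notMem_eq_zero h0, ?_⟩
  rw [← setIntegral_eq_integral_of_ae_compl_eq_zero h0, setIntegral_finset _ hint]
  rfl

/-- The sum of `h(x, s_x)` over the atoms `x`, written as an integral. -/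
noncomputable def atomSum (h : RSpace d → ℝ → ℝ) (η : DiscreteRadonMeasure d) : ℝ :=
  ∫ x, h x (η.weight x) * (η.weight x)⁻¹ ∂η.1

theorem measurable_atomSum {h : RSpace d → ℝ → ℝ} (hh : Measurable (Function.uncurry h)) :
    Measurable (atomSum h) :=
  (stronglyMeasurable_integral (f := fun η x => h x (η.weight x) * (η.weight x)⁻¹)
    ((hh.comp (measurable_snd.prodMk measurable_weight)).mul measurable_weight.inv)).measurable

theorem integrable_and_atomSum_eq_sum {η : DiscreteRadonMeasure d}
    (hη : η ∈ locallyFiniteAtoms d) {n : ℕ} {h : RSpace d → ℝ → ℝ}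
    (hh : ∀ x ∉ Metric.ball (0 : RSpace d) n, ∀ s, 0 < s → h x s = 0) :
    Integrable (fun x => h x (η.weight x) * (η.weight x)⁻¹) η.1 ∧
      atomSum h η = ∑ x ∈ (finite_atoms_inter_ball hη n).toFinset, h x (η.weight x) := by
  have := integrable_and_integral_eq_sum hη (n := n)
    (f := fun x => h x (η.weight x) * (η.weight x)⁻¹) (fun x hx => by
      by_cases h0 : x ∈ η.atoms
      · rw [hh x hx _ (weight_pos h0), zero_mul]
      · have : η.1 {x} = 0 := by
          by_contra hne
          exact h0 (pos_iff_ne_zero.2 hne)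
        simp [weight, Measure.real, this])
  refine ⟨this.1, this.2.trans (Finset.sum_congr rfl fun x hx => ?_)⟩
  have hx' : x ∈ η.atoms := ((Finite.mem_toFinset _).1 hx).1
  have := (weight_pos hx').ne'
  field_simp

theorem multipliable_and_tprod_eq_prod {η : DiscreteRadonMeasure d}
    (hη : η ∈ locallyFiniteAtoms d) {n : ℕ} {F : RSpace d → ℝ}
    (hF : ∀ x ∈ η.atoms, x ∉ Metric.ball (0 : RSpace d) n → F x = 1) :
    (Multipliable fun x : η.atoms => F x) ∧
      ∏' x : η.atoms, F x = ∏ x ∈ (finite_atoms_inter_ball hη n).toFinset, F x := by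
  have h1 : ∀ x ∉ (finite_atoms_inter_ball hη n).toFinset, η.atoms.mulIndicator F x = 1 := by
    intro x hx
    by_cases h0 : x ∈ η.atoms
    · rw [mulIndicator_of_mem h0]
      exact hF x h0 fun hx' => hx ((Finite.mem_toFinset _).2 ⟨h0, hx'⟩)
    · exact mulIndicator_of_notMem h0 _
  refine ⟨multipliable_subtype_iff_mulIndicator.2 (multipliable_of_ne_finset_one h1), ?_⟩
  rw [tprod_subtype, tprod_eq_prod h1]
  refine Finset.prod_congr rfl fun x hx => mulIndicator_of_mem ?_ _
  exact ((Finite.mem_toFinset _).1 hx).1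

end DiscreteRadonMeasure

theorem measurable_sigma_mk {ι : Type*} {β : ι → Type*} [∀ i, MeasurableSpace (β i)] (i : ι) :
    Measurable (Sigma.mk i : β i → Sigma β) :=
  Measurable.of_le_map (iInf_le _ i)

theorem measurable_sigma_iff {ι α : Type*} {β : ι → Type*} [∀ i, MeasurableSpace (β i)]
    [MeasurableSpace α] {f : Sigma β → α} :
    Measurable f ↔ ∀ i, Measurable fun b : β i => f ⟨i, b⟩ := by
  refine ⟨fun hf i => hf.comp (measurable_sigma_mk i), fun h s hs => ?_⟩
  exact MeasurableSpace.measurableSet_iInf.2 fun i => h i hs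

theorem measurableSet_sigma_iff {ι : Type*} {β : ι → Type*} [∀ i, MeasurableSpace (β i)]
    {s : Set (Sigma β)} : MeasurableSet s ↔ ∀ i, MeasurableSet (Sigma.mk i ⁻¹' s) :=
  MeasurableSpace.measurableSet_iInf

@[to_additive]
theorem measurable_tupleProd {Y M : Type*} [MeasurableSpace Y] [CommMonoid M] [MeasurableSpace M]
    [MeasurableMul₂ M] {u : Y → M} (hu : Measurable u) :
    Measurable fun c : Σ n : ℕ, Fin n → Y => ∏ i, u (c.2 i) := by
  refine measurable_sigma_iff.2 fun n => ?_
  change Measurable fun y : Fin n → Y => ∏ i, u (y i)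
  exact Finset.measurable_fun_prod _ fun i _ => hu.comp (measurable_pi_apply i)

/-- The law of the finite Poisson configuration with intensity `m`, as a random tuple of random
length. -/
noncomputable def poissonTuple {Y : Type*} [MeasurableSpace Y] (m : Measure Y) :
    Measure (Σ n : ℕ, Fin n → Y) :=
  Measure.sum fun n => ENNReal.ofReal (Real.exp (-m.real univ) / n.factorial) •
    (Measure.pi fun _ : Fin n => m).map (Sigma.mk n)

namespace poissonTuple

variable {Y : Type*} [MeasurableSpace Y] {m : Measure Y}

theorem ae_of_ae_pi {p : (Σ n : ℕ, Fin n → Y) → Prop} (hp : MeasurableSet {c | p c})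
    (h : ∀ n, ∀ᵐ y ∂(Measure.pi fun _ : Fin n => m), p ⟨n, y⟩) : ∀ᵐ c ∂poissonTuple m, p c := by
  refine Measure.ae_sum_iff.2 fun n => Measure.ae_smul_measure ?_ _
  exact (ae_map_iff (measurable_sigma_mk n).aemeasurable hp).2 (h n)

variable [IsFiniteMeasure m]

theorem integrable_prod {u : Y → ℂ} (hu : Integrable u m) (hum : Measurable u) :
    Integrable (fun c : Σ n : ℕ, Fin n → Y => ∏ i, u (c.2 i)) (poissonTuple m) := by
  have hmeas := measurable_tupleProd hum
  have hpi : ∀ n, Integrable (fun y : Fin n → Y => ∏ i, u (y i)) (Measure.pi fun _ => m) :=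
    fun n => Integrable.fintype_prod fun _ => hu
  refine integrable_sum_measure (fun n => ?_) ?_
  · refine Integrable.smul_measure ?_ ENNReal.ofReal_ne_top
    exact (integrable_map_measure hmeas.aestronglyMeasurable
      (measurable_sigma_mk n).aemeasurable).2 (hpi n)
  · have : ∀ n : ℕ, ∫ c : Σ n : ℕ, Fin n → Y, ‖∏ i, u (c.2 i)‖
        ∂(ENNReal.ofReal (Real.exp (-m.real univ) / n.factorial) •
          (Measure.pi fun _ : Fin n => m).map (Sigma.mk n)) =
        Real.exp (-m.real univ) * ((∫ y, ‖u y‖ ∂m) ^ n / n.factorial) := by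
      intro n
      rw [integral_smul_measure, integral_map (measurable_sigma_mk n).aemeasurable
        hmeas.norm.aestronglyMeasurable, ENNReal.toReal_ofReal (by positivity)]
      simp_rw [norm_prod]
      rw [integral_fintype_prod_eq_pow (fun y => ‖u y‖), Fintype.card_fin, smul_eq_mul]
      ring
    simp_rw [this]
    exact (Real.summable_pow_div_factorial _).mul_left _

/-- The generating functional of the finite Poisson configuration. -/
theorem integral_prod {u : Y → ℂ} (hu : Integrable u m) (hum : Measurable u) :
    ∫ c : Σ n : ℕ, Fin n → Y, ∏ i, u (c.2 i) ∂poissonTuple m = Complex.exp (∫ y, (u y - 1) ∂m) := by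
  have hmeas := measurable_tupleProd hum
  have h := integral_sum_measure (integrable_prod hu hum)
  rw [poissonTuple, h]
  have : ∀ n : ℕ, ∫ c : Σ n : ℕ, Fin n → Y, ∏ i, u (c.2 i)
        ∂(ENNReal.ofReal (Real.exp (-m.real univ) / n.factorial) •
          (Measure.pi fun _ : Fin n => m).map (Sigma.mk n)) =
        Complex.exp (-m.real univ) * ((∫ y, u y ∂m) ^ n / n.factorial) := by
    intro n
    rw [integral_smul_measure, integral_map (measurable_sigma_mk n).aemeasurable
      hmeas.aestronglyMeasurable, ENNReal.toReal_ofReal (by positivity)]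
    dsimp only
    rw [integral_fintype_prod_eq_pow, Fintype.card_fin, Complex.real_smul]
    push_cast
    ring
  simp_rw [this]
  rw [tsum_mul_left, integral_sub hu (integrable_const _), integral_const, Complex.real_smul,
    mul_one, sub_eq_neg_add, Complex.exp_add]
  congr 1
  rw [Complex.exp_eq_exp_ℂ, NormedSpace.exp_eq_tsum_div]

instance : IsProbabilityMeasure (poissonTuple m) := by
  have hi := integrable_prod (m := m) (u := fun _ => 1) (integrable_const _) measurable_const
  have h := integral_prod (m := m) (u := fun _ => 1) (integrable_const _) measurable_const
  simp only [Finset.prod_const_one, sub_self, integral_zero, Complex.exp_zero] at h hi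
  have hf : IsFiniteMeasure (poissonTuple m) := by
    simpa [integrable_const_iff, isFiniteMeasure_iff] using hi
  rw [integral_const, Complex.real_smul, mul_one] at h
  have h' : (poissonTuple m).real univ = 1 := by exact_mod_cast h
  exact isProbabilityMeasure_iff_real.2 h'

theorem ae_forall {p : Y → Prop} (hp : MeasurableSet {y | p y}) (h : ∀ᵐ y ∂m, p y) :
    ∀ᵐ c ∂poissonTuple m, ∀ i, p (c.2 i) := by
  refine ae_of_ae_pi (measurableSet_sigma_iff.2 fun n => ?_) fun n => ?_
  · have : Sigma.mk n ⁻¹' {c : Σ n : ℕ, Fin n → Y | ∀ i, p (c.2 i)} =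
        ⋂ i : Fin n, (fun y : Fin n → Y => y i) ⁻¹' {y | p y} := by
      ext y
      simp
    rw [this]
    exact MeasurableSet.iInter fun i => measurable_pi_apply i hp
  · exact eventually_all.2 fun i =>
      (Measure.tendsto_eval_ae_ae (μ := fun _ : Fin n => m) (i := i)).eventually h

theorem ae_injective {X : Type*} [MeasurableSpace X] [MeasurableEq X] {q : Y → X} (hq : Measurable q)
    (h : ∀ x, m (q ⁻¹' {x}) = 0) :
    ∀ᵐ c ∂poissonTuple m, Function.Injective fun i => q (c.2 i) := by
  have hms : ∀ n (i j : Fin n), MeasurableSet {y : Fin n → Y | q (y i) ≠ q (y j)} := fun n i j =>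
    (measurableSet_eq_fun (hq.comp (measurable_pi_apply i))
      (hq.comp (measurable_pi_apply j))).compl
  have hinj : ∀ n (y : Fin n → Y), (Function.Injective fun i => q (y i)) ↔
      ∀ i j, i ≠ j → q (y i) ≠ q (y j) := fun n y =>
    ⟨fun hy i j hij => hy.ne hij, fun hy i j hij => by_contra fun hne => hy i j hne hij⟩
  refine ae_of_ae_pi (measurableSet_sigma_iff.2 fun n => ?_) fun n => ?_
  · have : Sigma.mk n ⁻¹' {c : Σ n : ℕ, Fin n → Y | Function.Injective fun i => q (c.2 i)} =
        ⋂ (i : Fin n) (j : Fin n) (_ : i ≠ j), {y : Fin n → Y | q (y i) ≠ q (y j)} := by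
      ext y
      simp only [mem_preimage, mem_iInter]
      exact hinj n y
    rw [this]
    exact MeasurableSet.iInter fun i => MeasurableSet.iInter fun j =>
      MeasurableSet.iInter fun _ => hms n i j
  · simp only [hinj]
    refine eventually_all.2 fun i => eventually_all.2 fun j => ?_
    by_cases hij : i = j
    · exact Eventually.of_forall fun _ hne => absurd hij hne
    suffices ∀ᵐ y ∂(Measure.pi fun _ : Fin n => m), q (y i) ≠ q (y j) by
      filter_upwards [this] with y hy _ using hy
    obtain ⟨k, rfl⟩ : ∃ k, n = k + 1 := ⟨n - 1, by have := i.pos; omega⟩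
    obtain ⟨j', rfl⟩ := Fin.exists_succAbove_eq (Ne.symm hij)
    have hmp := measurePreserving_piFinSuccAbove (fun _ : Fin (k + 1) => m) i
    have hset : MeasurableSet {p : Y × (Fin k → Y) | q p.1 = q (p.2 j')} :=
      measurableSet_eq_fun (hq.comp measurable_fst)
        (hq.comp ((measurable_pi_apply j').comp measurable_snd))
    have h0 : (m.prod (Measure.pi fun _ : Fin k => m)) {p | q p.1 = q (p.2 j')} = 0 := by
      rw [Measure.prod_apply_symm hset, lintegral_eq_zero_iff (measurable_measure_prodMk_right hset)]
      exact Eventually.of_forall fun y => h (q (y j'))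
    have := hmp.measure_preimage hset.nullMeasurableSet
    rw [h0] at this
    refine measure_mono_null (fun y hy => ?_) this
    exact not_not.1 hy

end poissonTuple

/-- A family of finite tuples of marked points, one tuple for every annulus. -/
abbrev MarkedTuples (d : ℕ) : Type := ℕ → Σ n : ℕ, Fin n → RSpace d × ℝ

/-- The finite sum of point masses given by a tuple of marked points. -/
noncomputable def tupleMeasure {d : ℕ} (c : Σ n : ℕ, Fin n → RSpace d × ℝ) :
    Measure (RSpace d) :=
  ∑ i, ENNReal.ofReal (c.2 i).2 • Measure.dirac (c.2 i).1

theorem tupleMeasure_apply {d : ℕ} (c : Σ n : ℕ, Fin n → RSpace d × ℝ) {A : Set (RSpace d)}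
    (hA : MeasurableSet A) :
    tupleMeasure c A = ∑ i, ENNReal.ofReal (c.2 i).2 * A.indicator 1 (c.2 i).1 := by
  rw [tupleMeasure, Measure.finsetSum_apply]
  refine Finset.sum_congr rfl fun i _ => ?_
  rw [Measure.smul_apply, Measure.dirac_apply' _ hA, smul_eq_mul]

theorem measurable_tupleMeasure_apply {d : ℕ} {A : Set (RSpace d)} (hA : MeasurableSet A) :
    Measurable fun c : Σ n : ℕ, Fin n → RSpace d × ℝ => tupleMeasure c A := by
  simp_rw [tupleMeasure_apply _ hA]
  exact measurable_tupleSum (u := fun p : RSpace d × ℝ =>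
    ENNReal.ofReal p.2 * A.indicator (1 : RSpace d → ℝ≥0∞) p.1)
    (measurable_snd.ennreal_ofReal.mul ((measurable_one.indicator hA).comp measurable_fst))

theorem tupleMeasure_lt_top {d : ℕ} (c : Σ n : ℕ, Fin n → RSpace d × ℝ) (A : Set (RSpace d)) :
    tupleMeasure c A < ∞ := by
  refine (measure_mono (subset_univ A)).trans_lt ?_
  rw [tupleMeasure_apply _ MeasurableSet.univ]
  exact ENNReal.sum_lt_top.2 fun i _ => by simp

namespace MarkedTuples

variable {d : ℕ}

/-- The discrete measure with the given marked points, each tuple being restricted to its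
annulus. -/
noncomputable def toMeasure (ω : MarkedTuples d) : Measure (RSpace d) :=
  Measure.sum fun k => (tupleMeasure (ω k)).restrict (annulus d k)

theorem toMeasure_apply (ω : MarkedTuples d) {A : Set (RSpace d)} (hA : MeasurableSet A) :
    ω.toMeasure A = ∑' k, tupleMeasure (ω k) (A ∩ annulus d k) := by
  rw [toMeasure, Measure.sum_apply _ hA]
  exact tsum_congr fun k => Measure.restrict_apply hA

theorem toMeasure_apply_of_subset_annulus (ω : MarkedTuples d) {A : Set (RSpace d)}
    (hA : MeasurableSet A) {k : ℕ} (hk : A ⊆ annulus d k) :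
    ω.toMeasure A = tupleMeasure (ω k) A := by
  rw [toMeasure_apply _ hA, tsum_eq_single k, inter_eq_left.2 hk]
  intro j hj
  rw [((pairwise_disjoint_annulus d hj).symm.mono_left hk).inter_eq, measure_empty]

theorem isDiscreteRadon_toMeasure (ω : MarkedTuples d) : IsDiscreteRadon ω.toMeasure := by
  refine IsDiscreteRadon.of_countable (S := ⋃ k, range fun i => ((ω k).2 i).1) ⟨fun K hK => ?_⟩
    (countable_iUnion fun k => (finite_range _).countable) ?_
  · obtain ⟨r, hr⟩ := hK.isBounded.subset_ball (0 : RSpace d)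
    obtain ⟨n, hn⟩ := exists_nat_ge r
    refine (measure_mono (hr.trans (Metric.ball_subset_ball hn))).trans_lt ?_
    rw [toMeasure_apply _ Metric.isOpen_ball.measurableSet, tsum_eq_sum (s := Finset.range n)]
    · exact ENNReal.sum_lt_top.2 fun k _ => tupleMeasure_lt_top _ _
    · intro k hk
      have : Metric.ball (0 : RSpace d) n ∩ annulus d k = ∅ :=
        eq_empty_of_forall_notMem fun x hx =>
          hk (Finset.mem_range.2 ((mem_ball_iff_of_mem_annulus hx.2).1 hx.1))
      rw [this, measure_empty]
  · have hS : (⋃ k, range fun i => ((ω k).2 i).1).Countable :=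
      countable_iUnion fun k => (finite_range _).countable
    rw [toMeasure_apply _ hS.measurableSet.compl, ENNReal.tsum_eq_zero]
    intro k
    refine measure_mono_null inter_subset_left ?_
    rw [tupleMeasure_apply _ hS.measurableSet.compl]
    refine Finset.sum_eq_zero fun i _ => ?_
    rw [indicator_of_notMem, mul_zero]
    exact fun h => h (mem_iUnion.2 ⟨k, i, rfl⟩)

/-- The discrete Radon measure with the given marked points. -/
noncomputable def toDiscrete (ω : MarkedTuples d) : DiscreteRadonMeasure d :=
  ⟨ω.toMeasure, ω.isDiscreteRadon_toMeasure⟩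

theorem measurable_toDiscrete : Measurable (toDiscrete (d := d)) := by
  refine Measurable.subtype_mk (f := fun ω : MarkedTuples d => ω.toMeasure) ?_
  refine Measure.measurable_of_measurable_coe _ fun A hA => ?_
  simp_rw [toMeasure_apply _ hA]
  exact Measurable.tsum fun k =>
    (measurable_tupleMeasure_apply (hA.inter (measurableSet_annulus d k))).comp
      (measurable_pi_apply k)

/-- Every tuple lies in its annulus, has positive marks, and consists of distinct points. -/
def IsSimple (ω : MarkedTuples d) : Prop :=
  ∀ k, (∀ i, ((ω k).2 i).1 ∈ annulus d k ∧ 0 < ((ω k).2 i).2) ∧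
    Function.Injective fun i => ((ω k).2 i).1

theorem IsSimple.toMeasure_singleton {ω : MarkedTuples d} (hω : ω.IsSimple) (k : ℕ)
    (i : Fin (ω k).1) :
    ω.toMeasure {((ω k).2 i).1} = ENNReal.ofReal ((ω k).2 i).2 := by
  rw [toMeasure_apply_of_subset_annulus _ (measurableSet_singleton _)
    (singleton_subset_iff.2 ((hω k).1 i).1), tupleMeasure_apply _ (measurableSet_singleton _),
    Finset.sum_eq_single i]
  · simp
  · intro j _ hj
    rw [indicator_of_notMem, mul_zero]
    exact fun h => hj ((hω k).2 h)
  · simp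

theorem IsSimple.weight_toDiscrete {ω : MarkedTuples d} (hω : ω.IsSimple) (k : ℕ)
    (i : Fin (ω k).1) : ω.toDiscrete.weight ((ω k).2 i).1 = ((ω k).2 i).2 := by
  have := congrArg ENNReal.toReal (hω.toMeasure_singleton k i)
  rwa [ENNReal.toReal_ofReal ((hω k).1 i).2.le] at this

theorem IsSimple.restrict_ball {ω : MarkedTuples d} (hω : ω.IsSimple) (n : ℕ) :
    ω.toMeasure.restrict (Metric.ball 0 n) = ∑ k ∈ Finset.range n, tupleMeasure (ω k) := by
  ext A hA
  rw [Measure.restrict_apply hA, toMeasure_apply _ (hA.inter Metric.isOpen_ball.measurableSet),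
    Measure.finsetSum_apply, tsum_eq_sum (s := Finset.range n)]
  · refine Finset.sum_congr rfl fun k hk => ?_
    rw [tupleMeasure_apply _ hA, tupleMeasure_apply _
      ((hA.inter Metric.isOpen_ball.measurableSet).inter (measurableSet_annulus d k))]
    refine Finset.sum_congr rfl fun i _ => ?_
    have h1 := ((hω k).1 i).1
    have h2 := (mem_ball_iff_of_mem_annulus h1).2 (Finset.mem_range.1 hk)
    by_cases h : ((ω k).2 i).1 ∈ A
    · have h3 : ((ω k).2 i).1 ∈ A ∩ Metric.ball 0 n ∩ annulus d k := ⟨⟨h, h2⟩, h1⟩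
      rw [indicator_of_mem h, indicator_of_mem h3]
    · rw [indicator_of_notMem h, indicator_of_notMem fun h' => h h'.1.1]
  · intro k hk
    have : A ∩ Metric.ball (0 : RSpace d) n ∩ annulus d k = ∅ :=
      eq_empty_of_forall_notMem fun x hx =>
        hk (Finset.mem_range.2 ((mem_ball_iff_of_mem_annulus hx.2).1 hx.1.2))
    rw [this, measure_empty]

theorem IsSimple.mem_locallyFiniteAtoms {ω : MarkedTuples d} (hω : ω.IsSimple) :
    ω.toDiscrete ∈ DiscreteRadonMeasure.locallyFiniteAtoms d := by
  intro n
  change ∫⁻ x in Metric.ball 0 n, (ω.toMeasure {x})⁻¹ ∂ω.toMeasure < ∞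
  rw [hω.restrict_ball, lintegral_finsetSum_measure]
  refine ENNReal.sum_lt_top.2 fun k _ => ?_
  rw [tupleMeasure, lintegral_finsetSum_measure]
  refine ENNReal.sum_lt_top.2 fun i _ => ?_
  rw [lintegral_smul_measure, lintegral_dirac, hω.toMeasure_singleton, smul_eq_mul]
  exact ENNReal.mul_inv_le_one _ |>.trans_lt ENNReal.one_lt_top

theorem IsSimple.integral_toDiscrete {ω : MarkedTuples d} (hω : ω.IsSimple) {n : ℕ}
    {F : RSpace d → ℝ} (hF : ∀ x ∉ Metric.ball (0 : RSpace d) n, F x = 0) :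
    ∫ x, F x ∂ω.toDiscrete.1 =
      ∑ k ∈ Finset.range n, ∑ i, ((ω k).2 i).2 * F ((ω k).2 i).1 := by
  change ∫ x, F x ∂ω.toMeasure = _
  have hint : ∀ k i, Integrable F (ENNReal.ofReal ((ω k).2 i).2 • Measure.dirac ((ω k).2 i).1) :=
    fun k i => (integrable_dirac (by simp)).smul_measure ENNReal.ofReal_ne_top
  have hint' : ∀ k, Integrable F (tupleMeasure (ω k)) := fun k =>
    integrable_finsetSum_measure.2 fun i _ => hint k i
  rw [← setIntegral_eq_integral_of_forall_compl_eq_zero hF, hω.restrict_ball,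
    integral_finsetSum_measure fun k _ => hint' k]
  refine Finset.sum_congr rfl fun k _ => ?_
  rw [tupleMeasure, integral_finsetSum_measure fun i _ => hint k i]
  refine Finset.sum_congr rfl fun i _ => ?_
  rw [integral_smul_measure, integral_dirac, ENNReal.toReal_ofReal ((hω k).1 i).2.le, smul_eq_mul]

theorem IsSimple.atomSum_toDiscrete {ω : MarkedTuples d} (hω : ω.IsSimple) {n : ℕ}
    {h : RSpace d → ℝ → ℝ} (hh : ∀ x ∉ Metric.ball (0 : RSpace d) n, ∀ s, h x s = 0) :
    DiscreteRadonMeasure.atomSum h ω.toDiscrete =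
      ∑ k ∈ Finset.range n, ∑ i, h ((ω k).2 i).1 ((ω k).2 i).2 := by
  rw [DiscreteRadonMeasure.atomSum, hω.integral_toDiscrete (n := n)]
  · refine Finset.sum_congr rfl fun k _ => Finset.sum_congr rfl fun i _ => ?_
    have := ((hω k).1 i).2.ne'
    rw [hω.weight_toDiscrete]
    field_simp
  · intro x hx
    rw [hh x hx, zero_mul]

end MarkedTuples

/-- The generating functional of `μ` is the one of the Poisson point process of marked points with
intensity `m`. -/
def HasPoissonFunctional {d : ℕ} (m : Measure (RSpace d × ℝ))
    (μ : Measure (DiscreteRadonMeasure d)) : Prop :=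
  ∀ (n : ℕ) (h : RSpace d → ℝ → ℝ) (f : RSpace d → ℝ), Measurable (Function.uncurry h) →
    Measurable f → (∀ x ∉ Metric.ball (0 : RSpace d) n, ∀ s, h x s = 0) →
    (∀ x ∉ Metric.ball (0 : RSpace d) n, f x = 0) →
    IntegrableOn (fun p => Real.exp (h p.1 p.2)) (Metric.ball (0 : RSpace d) n ×ˢ univ) m →
    ∫ η, Complex.exp ((DiscreteRadonMeasure.atomSum h η : ℝ) +
        Complex.I * ((∫ x, f x ∂η.1 : ℝ) : ℂ)) ∂μ =
      Complex.exp (∫ p in Metric.ball (0 : RSpace d) n ×ˢ univ,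
        (Complex.exp ((h p.1 p.2 : ℝ) + Complex.I * ((p.2 * f p.1 : ℝ) : ℂ)) - 1) ∂m)

/-- There is a Poisson random discrete measure with locally finite, diffuse intensity `m`. -/
theorem exists_hasPoissonFunctional {d : ℕ} {m : Measure (RSpace d × ℝ)}
    (hfin : ∀ k, m (annulus d k ×ˢ univ) < ∞) (hpos : ∀ᵐ p ∂m, 0 < p.2)
    (hdiff : ∀ x, m (Prod.fst ⁻¹' {x}) = 0) :
    ∃ μ : Measure (DiscreteRadonMeasure d), IsProbabilityMeasure μ ∧
      (∀ᵐ η ∂μ, η ∈ DiscreteRadonMeasure.locallyFiniteAtoms d) ∧ HasPoissonFunctional m μ := by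
  let mk : ℕ → Measure (RSpace d × ℝ) := fun k => m.restrict (annulus d k ×ˢ univ)
  have hmk : ∀ k, IsFiniteMeasure (mk k) := fun k => ⟨by simpa [mk] using hfin k⟩
  have hms : ∀ k, MeasurableSet (annulus d k ×ˢ (univ : Set ℝ)) := fun k =>
    (measurableSet_annulus d k).prod MeasurableSet.univ
  let Q : Measure (MarkedTuples d) := Measure.infinitePi fun k => poissonTuple (mk k)
  have hQ : IsProbabilityMeasure Q := by infer_instance
  have hsimple : ∀ᵐ ω ∂Q, ω.IsSimple := by
    refine ae_all_iff.2 fun k => ?_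
    refine (measurePreserving_eval_infinitePi (fun k => poissonTuple (mk k)) k
      ).quasiMeasurePreserving.ae (p := fun c : Σ n : ℕ, Fin n → RSpace d × ℝ =>
        (∀ i, (c.2 i).1 ∈ annulus d k ∧ 0 < (c.2 i).2) ∧ Function.Injective fun i => (c.2 i).1) ?_
    refine (poissonTuple.ae_forall (p := fun p : RSpace d × ℝ => p.1 ∈ annulus d k ∧ 0 < p.2)
      ?_ ?_).and (poissonTuple.ae_injective measurable_fst fun x => ?_)
    · exact (measurable_fst (measurableSet_annulus d k)).inter
        (measurableSet_lt measurable_const measurable_snd)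
    · filter_upwards [ae_restrict_mem (hms k), ae_restrict_of_ae hpos] with p h1 h2
      exact ⟨h1.1, h2⟩
    · exact le_antisymm ((Measure.restrict_apply_le _ _).trans (hdiff x).le) zero_le
  have hmeas := MarkedTuples.measurable_toDiscrete (d := d)
  refine ⟨Q.map MarkedTuples.toDiscrete, Measure.isProbabilityMeasure_map hmeas.aemeasurable,
    ?_, ?_⟩
  · refine (ae_map_iff hmeas.aemeasurable
      (DiscreteRadonMeasure.measurableSet_locallyFiniteAtoms d)).2 ?_
    filter_upwards [hsimple] with ω hω using hω.mem_locallyFiniteAtoms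
  intro n h f hh hf hh0 hf0 hint
  let u : RSpace d × ℝ → ℂ := fun p =>
    Complex.exp ((h p.1 p.2 : ℝ) + Complex.I * ((p.2 * f p.1 : ℝ) : ℂ))
  have hu : Measurable u := by
    have h1 : Measurable fun p : RSpace d × ℝ => h p.1 p.2 := hh
    have h2 : Measurable fun p : RSpace d × ℝ => p.2 * f p.1 :=
      measurable_snd.mul (hf.comp measurable_fst)
    fun_prop
  have hunorm : ∀ p, ‖u p‖ = Real.exp (h p.1 p.2) := fun p => by
    simp [u, Complex.norm_exp]
  have huint : IntegrableOn u (Metric.ball (0 : RSpace d) n ×ˢ univ) m := by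
    refine Integrable.mono' hint hu.aestronglyMeasurable (Eventually.of_forall fun p => ?_)
    exact (hunorm p).le
  have hsub : ∀ k ∈ Finset.range n, annulus d k ×ˢ (univ : Set ℝ) ⊆
      Metric.ball (0 : RSpace d) n ×ˢ univ := fun k hk => prod_mono_left fun x hx =>
    (mem_ball_iff_of_mem_annulus hx).2 (Finset.mem_range.1 hk)
  have hball : Metric.ball (0 : RSpace d) n ×ˢ (univ : Set ℝ) =
      ⋃ k ∈ Finset.range n, annulus d k ×ˢ (univ : Set ℝ) := by
    rw [← iUnion_annulus_lt]
    ext p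
    simp
  let G : (Σ n : ℕ, Fin n → RSpace d × ℝ) → ℂ := fun c => ∏ i, u (c.2 i)
  have hG : Measurable G := measurable_tupleProd hu
  have hstep : ∀ᵐ ω : MarkedTuples d ∂Q, Complex.exp ((DiscreteRadonMeasure.atomSum h ω.toDiscrete : ℝ) +
      Complex.I * ((∫ x, f x ∂ω.toDiscrete.1 : ℝ) : ℂ)) =
      (fun y : (k : Finset.range n) → Σ n : ℕ, Fin n → RSpace d × ℝ => ∏ k, G (y k))
        ((Finset.range n).restrict ω) := by
    filter_upwards [hsimple] with ω hω
    rw [hω.atomSum_toDiscrete hh0, hω.integral_toDiscrete hf0]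
    simp only [Finset.restrict, Finset.prod_coe_sort (Finset.range n) fun k => G (ω k)]
    push_cast
    rw [Finset.mul_sum, ← Finset.sum_add_distrib, Complex.exp_sum]
    refine Finset.prod_congr rfl fun k _ => ?_
    rw [Finset.mul_sum, ← Finset.sum_add_distrib, Complex.exp_sum]
    refine Finset.prod_congr rfl fun i _ => ?_
    simp [u]
  rw [integral_map hmeas.aemeasurable]
  swap
  · have h1 := DiscreteRadonMeasure.measurable_atomSum hh
    have h2 := DiscreteRadonMeasure.measurable_integral hf
    exact (by fun_prop : Measurable fun η : DiscreteRadonMeasure d =>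
      Complex.exp ((DiscreteRadonMeasure.atomSum h η : ℝ) +
        Complex.I * ((∫ x, f x ∂η.1 : ℝ) : ℂ))).aestronglyMeasurable
  have hGprod : Measurable fun y : (k : Finset.range n) → Σ n : ℕ, Fin n → RSpace d × ℝ =>
      ∏ k, G (y k) := Finset.measurable_fun_prod _ fun k _ => hG.comp (measurable_pi_apply k)
  rw [integral_congr_ae hstep]
  refine (integral_restrict_infinitePi (fun k => poissonTuple (mk k))
    hGprod.aestronglyMeasurable).trans ?_
  rw [integral_fintype_prod_eq_prod (fun _ => G)]
  have hk : ∀ k ∈ Finset.range n, ∫ c, G c ∂poissonTuple (mk k) =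
      Complex.exp (∫ p in annulus d k ×ˢ univ, (u p - 1) ∂m) := fun k hk =>
    poissonTuple.integral_prod (huint.mono_set (hsub k hk)) hu
  rw [Finset.prod_coe_sort (Finset.range n) fun k => ∫ c, G c ∂poissonTuple (mk k),
    Finset.prod_congr rfl hk, ← Complex.exp_sum, hball, integral_biUnion_finset]
  · exact fun k _ => hms k
  · exact fun i _ j _ hij => Disjoint.set_prod_left (pairwise_disjoint_annulus d hij) _ _
  · exact fun k hk => (huint.mono_set (hsub k hk)).sub
      (integrableOn_const (hfin k).ne)

theorem lintegral_Ioi_zero_scale {c : ℝ} (hc : 0 < c) (g : ℝ → ℝ≥0∞) :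
    ∫⁻ s in Ioi (0 : ℝ), g s = ∫⁻ s in Ioi (0 : ℝ), ENNReal.ofReal c * g (c * s) := by
  have h := lintegral_image_eq_lintegral_abs_deriv_mul (s := Ioi (0 : ℝ)) (f := fun s => c * s)
    (f' := fun _ => c) measurableSet_Ioi
    (fun x _ => by simpa using ((hasDerivAt_id x).const_mul c).hasDerivWithinAt)
    (fun x _ y _ hxy => mul_left_cancel₀ hc.ne' hxy) g
  have himg : (fun s => c * s) '' Ioi (0 : ℝ) = Ioi 0 := by
    ext y
    constructor
    · rintro ⟨s, hs, rfl⟩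
      exact mul_pos hc hs
    · intro hy
      exact ⟨c⁻¹ * y, mul_pos (inv_pos.2 hc) hy, by field_simp⟩
  rwa [himg, abs_of_pos hc] at h

section LevyMeasure

variable {d : ℕ} {l : RSpace d → ℝ → ℝ}

theorem measurable_levyDensity (hl_meas : Measurable (Function.uncurry l)) :
    Measurable fun p : RSpace d × ℝ => l p.1 p.2 / p.2 :=
  (show Measurable fun p : RSpace d × ℝ => l p.1 p.2 from hl_meas).div measurable_snd

theorem ae_pos_of_prod_Ioi (ν : Measure (RSpace d)) [SFinite ν] :
    ∀ᵐ p ∂ν.prod (volume.restrict (Ioi (0 : ℝ))), 0 < p.2 :=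
  Measure.quasiMeasurePreserving_snd.ae (ae_restrict_mem measurableSet_Ioi)

theorem ae_pos_levyMeasure (l : RSpace d → ℝ → ℝ) : ∀ᵐ p ∂levyMeasure l, 0 < p.2 :=
  (withDensity_absolutelyContinuous _ _).ae_le (ae_pos_of_prod_Ioi _)

theorem levyMeasure_prod_univ (A : Set (RSpace d)) :
    levyMeasure l (A ×ˢ univ) = levyMeasure l (A ×ˢ Ioi 0) := by
  refine measure_congr ?_
  filter_upwards [ae_pos_levyMeasure l] with p hp
  exact propext ⟨fun h => ⟨h.1, hp⟩, fun h => ⟨h.1, trivial⟩⟩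

theorem levyMeasure_fst_preimage_singleton (hd : 1 ≤ d) (x : RSpace d) :
    levyMeasure l (Prod.fst ⁻¹' {x}) = 0 := by
  have : Nonempty (Fin d) := ⟨⟨0, hd⟩⟩
  refine withDensity_absolutelyContinuous _ _ ?_
  rw [← prod_univ, Measure.prod_prod, measure_singleton, zero_mul]

theorem lintegral_levyMeasure (hl_meas : Measurable (Function.uncurry l))
    {G : RSpace d × ℝ → ℝ≥0∞} (hG : Measurable G) :
    ∫⁻ p, G p ∂levyMeasure l =
      ∫⁻ x, ∫⁻ s in Ioi (0 : ℝ), ENNReal.ofReal (l x s / s) * G (x, s) := by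
  have h := (measurable_levyDensity hl_meas).ennreal_ofReal
  rw [levyMeasure, lintegral_withDensity_eq_lintegral_mul _ h hG,
    lintegral_prod _ (h.mul hG).aemeasurable]
  rfl

end LevyMeasure

namespace SemidirectGroup

variable {d : ℕ} (g : SemidirectGroup d)

theorem current_pos (x : RSpace d) : 0 < g.current x := (g.left.1 x).2

theorem contDiff_diffeo : ContDiff ℝ ((⊤ : ℕ∞) : WithTop ℕ∞) g.diffeo := g.right.2.1

theorem contDiff_diffeo_symm : ContDiff ℝ ((⊤ : ℕ∞) : WithTop ℕ∞) g.diffeo.symm := g.right.2.2.1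

theorem continuous_diffeo : Continuous g.diffeo := diff0_continuous g.right

theorem continuous_diffeo_symm : Continuous g.diffeo.symm := diff0_continuous_symm g.right

theorem differentiable_diffeo_symm : Differentiable ℝ g.diffeo.symm :=
  g.contDiff_diffeo_symm.differentiable (by simp)

theorem differentiable_diffeo : Differentiable ℝ g.diffeo :=
  g.contDiff_diffeo.differentiable (by simp)

theorem continuous_jacobian : Continuous g.jacobian :=
  (ContinuousLinearMap.continuous_det.comp
    (g.contDiff_diffeo_symm.continuous_fderiv (by simp))).abs

theorem jacobian_pos (x : RSpace d) : 0 < g.jacobian x := by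
  refine abs_pos.2 fun h0 => ?_
  have h := (g.differentiable_diffeo (g.diffeo.symm x)).hasFDerivAt.comp x
    (g.differentiable_diffeo_symm x).hasFDerivAt
  have hid : g.diffeo ∘ g.diffeo.symm = id := funext g.diffeo.apply_symm_apply
  rw [hid] at h
  have h1 := congrArg ContinuousLinearMap.det (h.unique (hasFDerivAt_id x))
  have h2 : (LinearMap.det (fderiv ℝ g.diffeo (g.diffeo.symm x) : RSpace d →ₗ[ℝ] RSpace d)) *
      LinearMap.det (fderiv ℝ g.diffeo.symm x : RSpace d →ₗ[ℝ] RSpace d) = 1 := by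
    rw [← LinearMap.det_comp]
    simpa [ContinuousLinearMap.det] using h1
  have h3 : LinearMap.det (fderiv ℝ g.diffeo.symm x : RSpace d →ₗ[ℝ] RSpace d) = 0 := h0
  rw [h3, mul_zero] at h2
  exact zero_ne_one h2

/-- The element `g` acts trivially outside the ball of radius `n`. -/
def TrivialOutside (n : ℕ) : Prop :=
  ∀ x ∉ Metric.ball (0 : RSpace d) n, g.diffeo x = x ∧ g.diffeo.symm x = x ∧ g.current x = 1 ∧
    g.jacobian x = 1

theorem exists_trivialOutside : ∃ n, g.TrivialOutside n := by
  obtain ⟨-, -, K, hK, hφ⟩ := g.right.2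
  obtain ⟨-, L, hL, hθ⟩ := g.left.2
  obtain ⟨r, hr⟩ := (hK.union hL).isBounded.subset_ball (0 : RSpace d)
  obtain ⟨n, hn⟩ := exists_nat_ge r
  have hsymm : ∀ y ∉ K, g.diffeo.symm y = y := fun y hy =>
    (Equiv.symm_apply_eq _).2 (hφ y hy).symm
  refine ⟨n, fun x hx => ?_⟩
  have hx' : x ∉ K ∪ L := fun h => hx (Metric.ball_subset_ball hn (hr h))
  rw [mem_union, not_or] at hx'
  refine ⟨hφ x hx'.1, hsymm x hx'.1, ?_, ?_⟩
  · rw [current, hθ x hx'.2]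
    rfl
  · have : g.diffeo.symm =ᶠ[𝓝 x] id := by
      filter_upwards [hK.isClosed.isOpen_compl.mem_nhds hx'.1] with y hy using hsymm y hy
    rw [jacobian, this.fderiv_eq, fderiv_id]
    simp [ContinuousLinearMap.det]

variable {g}

theorem TrivialOutside.mono {n m : ℕ} (h : g.TrivialOutside n) (hnm : n ≤ m) :
    g.TrivialOutside m := fun x hx =>
  h x fun hx' => hx (Metric.ball_subset_ball (by exact_mod_cast hnm) hx')

theorem TrivialOutside.diffeo_mem_ball_iff {n : ℕ} (h : g.TrivialOutside n) (x : RSpace d) :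
    g.diffeo x ∈ Metric.ball (0 : RSpace d) n ↔ x ∈ Metric.ball (0 : RSpace d) n := by
  constructor
  · intro hx
    by_contra hx'
    rw [(h x hx').1] at hx
    exact hx' hx
  · intro hx
    by_contra hx'
    have := (h _ hx').2.1
    rw [Equiv.symm_apply_apply] at this
    exact hx' (this ▸ hx)

variable (g)

/-- The action on marked points, `(x, s) ↦ (φ(x), θ(φ(x)) s)`. -/
def actMarked (p : RSpace d × ℝ) : RSpace d × ℝ :=
  (g.diffeo p.1, g.current (g.diffeo p.1) * p.2)

theorem measurable_actMarked : Measurable g.actMarked :=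
  (g.measurable_diffeo.comp measurable_fst).prodMk
    ((g.continuous_current.measurable.comp (g.measurable_diffeo.comp measurable_fst)).mul
      measurable_snd)

/-- The density of the image of `(l(x,s) / s) dx ds` under the action on marked points. -/
noncomputable def markedDensity (l : RSpace d → ℝ → ℝ) (x : RSpace d) (s : ℝ) : ℝ :=
  l (g.diffeo.symm x) ((g.current x)⁻¹ * s) / l x s * g.jacobian x

variable {l : RSpace d → ℝ → ℝ}

theorem markedDensity_pos (hl_pos : ∀ x : RSpace d, ∀ s : ℝ, 0 < s → 0 < l x s) (x : RSpace d)
    {s : ℝ} (hs : 0 < s) : 0 < g.markedDensity l x s :=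
  mul_pos (div_pos (hl_pos _ _ (mul_pos (inv_pos.2 (g.current_pos x)) hs)) (hl_pos _ _ hs))
    (g.jacobian_pos x)

theorem measurable_markedDensity (hl_meas : Measurable (Function.uncurry l)) :
    Measurable (Function.uncurry (g.markedDensity l)) := by
  have h1 : Measurable fun p : RSpace d × ℝ =>
      l (g.diffeo.symm p.1) ((g.current p.1)⁻¹ * p.2) :=
    hl_meas.comp ((g.continuous_diffeo_symm.measurable.comp measurable_fst).prodMk
      ((g.continuous_current.measurable.comp measurable_fst).inv.mul measurable_snd))
  exact (h1.div hl_meas).mul (g.continuous_jacobian.measurable.comp measurable_fst)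

theorem map_actMarked_levyMeasure (hl_meas : Measurable (Function.uncurry l))
    (hl_pos : ∀ x : RSpace d, ∀ s : ℝ, 0 < s → 0 < l x s) :
    (levyMeasure l).map g.actMarked =
      (levyMeasure l).withDensity fun p => ENNReal.ofReal (g.markedDensity l p.1 p.2) := by
  ext A hA
  have hρ : Measurable fun p : RSpace d × ℝ => ENNReal.ofReal (g.markedDensity l p.1 p.2) :=
    (g.measurable_markedDensity hl_meas).ennreal_ofReal
  have h1A : Measurable (A.indicator (1 : RSpace d × ℝ → ℝ≥0∞)) := measurable_one.indicator hA
  rw [← lintegral_indicator_one hA, lintegral_map h1A g.measurable_actMarked,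
    lintegral_levyMeasure hl_meas (G := fun p => A.indicator 1 (g.actMarked p))
      (h1A.comp g.measurable_actMarked), withDensity_apply _ hA,
    ← lintegral_indicator hA, lintegral_levyMeasure hl_meas (hρ.indicator hA)]
  have hchange := lintegral_image_eq_lintegral_abs_det_fderiv_mul (volume : Measure (RSpace d))
    MeasurableSet.univ (f := g.diffeo.symm) (f' := fun x => fderiv ℝ g.diffeo.symm x)
    (fun x _ => (g.differentiable_diffeo_symm x).hasFDerivAt.hasFDerivWithinAt)
    g.diffeo.symm.injective.injOn
  rw [image_univ, g.diffeo.symm.surjective.range_eq] at hchange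
  simp only [Measure.restrict_univ] at hchange
  rw [hchange]
  refine lintegral_congr fun y => ?_
  have hθ := g.current_pos y
  rw [lintegral_Ioi_zero_scale (inv_pos.2 hθ), ← lintegral_const_mul' _ _ ENNReal.ofReal_ne_top]
  refine setLIntegral_congr_fun measurableSet_Ioi fun s hs => ?_
  have hs' : 0 < s := hs
  have hact : g.actMarked (g.diffeo.symm y, (g.current y)⁻¹ * s) = (y, s) := by
    simp only [actMarked, Equiv.apply_symm_apply]
    rw [mul_inv_cancel_left₀ hθ.ne']
  simp only [hact]
  by_cases hyA : (y, s) ∈ A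
  · rw [indicator_of_mem hyA, indicator_of_mem hyA, Pi.one_apply, mul_one]
    have hJ := g.jacobian_pos y
    have hl1 := hl_pos y s hs'
    have hl2 := hl_pos (g.diffeo.symm y) _ (mul_pos (inv_pos.2 hθ) hs')
    rw [← ENNReal.ofReal_mul (inv_pos.2 hθ).le, ← ENNReal.ofReal_mul (abs_nonneg _),
      ← ENNReal.ofReal_mul (div_pos hl1 hs').le]
    congr 1
    change g.jacobian y * _ = _
    rw [markedDensity]
    field_simp
  · rw [indicator_of_notMem hyA, indicator_of_notMem hyA]
    simp

variable {g}

theorem TrivialOutside.log_markedDensity_eq_zero {n : ℕ} (h : g.TrivialOutside n)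
    {x : RSpace d} (hx : x ∉ Metric.ball (0 : RSpace d) n) (s : ℝ) :
    Real.log (g.markedDensity l x s) = 0 := by
  obtain ⟨-, h2, h3, h4⟩ := h x hx
  rw [markedDensity, h2, h3, h4, inv_one, one_mul, mul_one]
  rcases eq_or_ne (l x s) 0 with h0 | h0
  · simp [h0]
  · simp [div_self h0]

theorem TrivialOutside.lintegral_markedDensity {n : ℕ} (h : g.TrivialOutside n)
    (hl_meas : Measurable (Function.uncurry l))
    (hl_pos : ∀ x : RSpace d, ∀ s : ℝ, 0 < s → 0 < l x s) :
    ∫⁻ p in Metric.ball (0 : RSpace d) n ×ˢ univ,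
      ENNReal.ofReal (g.markedDensity l p.1 p.2) ∂levyMeasure l =
      levyMeasure l (Metric.ball (0 : RSpace d) n ×ˢ univ) := by
  have hms : MeasurableSet (Metric.ball (0 : RSpace d) n ×ˢ (univ : Set ℝ)) :=
    Metric.isOpen_ball.measurableSet.prod MeasurableSet.univ
  rw [← withDensity_apply _ hms, ← g.map_actMarked_levyMeasure hl_meas hl_pos,
    Measure.map_apply g.measurable_actMarked hms]
  congr 1
  ext p
  simp only [mem_preimage, mem_prod, mem_univ, and_true]
  exact h.diffeo_mem_ball_iff p.1

theorem TrivialOutside.integrableOn_markedDensity {n : ℕ} (h : g.TrivialOutside n)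
    (hl_meas : Measurable (Function.uncurry l))
    (hl_pos : ∀ x : RSpace d, ∀ s : ℝ, 0 < s → 0 < l x s)
    (hfin : levyMeasure l (Metric.ball (0 : RSpace d) n ×ˢ univ) < ∞) :
    IntegrableOn (fun p => g.markedDensity l p.1 p.2) (Metric.ball (0 : RSpace d) n ×ˢ univ)
        (levyMeasure l) ∧
      ∫ p in Metric.ball (0 : RSpace d) n ×ˢ univ, g.markedDensity l p.1 p.2 ∂levyMeasure l =
        (levyMeasure l).real (Metric.ball (0 : RSpace d) n ×ˢ univ) := by
  have hm : AEStronglyMeasurable (fun p : RSpace d × ℝ => g.markedDensity l p.1 p.2)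
      ((levyMeasure l).restrict (Metric.ball (0 : RSpace d) n ×ˢ univ)) :=
    (show Measurable fun p : RSpace d × ℝ => g.markedDensity l p.1 p.2 from
      g.measurable_markedDensity hl_meas).aestronglyMeasurable
  have h0 : ∀ᵐ p ∂(levyMeasure l).restrict (Metric.ball (0 : RSpace d) n ×ˢ univ),
      0 ≤ g.markedDensity l p.1 p.2 := by
    filter_upwards [ae_restrict_of_ae (ae_pos_levyMeasure l)] with p hp
    exact (g.markedDensity_pos hl_pos p.1 hp).le
  have h1 := h.lintegral_markedDensity hl_meas hl_pos
  refine ⟨⟨hm, ?_⟩, ?_⟩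
  · rw [hasFiniteIntegral_iff_ofReal h0, h1]
    exact hfin
  · rw [integral_eq_lintegral_of_nonneg_ae h0 hm, h1]
    rfl

theorem TrivialOutside.integrable_compensator {n : ℕ} (h : g.TrivialOutside n)
    (hl_meas : Measurable (Function.uncurry l))
    (hl_pos : ∀ x : RSpace d, ∀ s : ℝ, 0 < s → 0 < l x s)
    (hfin : levyMeasure l (Metric.ball (0 : RSpace d) n ×ˢ univ) < ∞) :
    Integrable (fun p : RSpace d × ℝ => compensator l g p.1 p.2)
        (volume.prod (volume.restrict (Ioi (0 : ℝ)))) ∧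
      ∫ x, ∫ s in Ioi (0 : ℝ), compensator l g x s = 0 := by
  set B := Metric.ball (0 : RSpace d) n
  have hBm : MeasurableSet B := Metric.isOpen_ball.measurableSet
  have hBm' : MeasurableSet (B ×ˢ (univ : Set ℝ)) := hBm.prod MeasurableSet.univ
  set π : Measure (RSpace d × ℝ) := volume.prod (volume.restrict (Ioi (0 : ℝ))) with hπ
  have hπB : π.restrict (B ×ˢ univ) = (volume.restrict B).prod (volume.restrict (Ioi 0)) := by
    rw [hπ, ← Measure.prod_restrict, Measure.restrict_univ]
  let a : RSpace d × ℝ → ℝ := fun p => l p.1 p.2 / p.2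
  let b : RSpace d × ℝ → ℝ := fun p => l p.1 ((g.current p.1)⁻¹ * p.2) / p.2
  have ha : Measurable a := measurable_levyDensity hl_meas
  have hb : Measurable b := by
    have h1 : Measurable fun p : RSpace d × ℝ => l p.1 ((g.current p.1)⁻¹ * p.2) :=
      hl_meas.comp (measurable_fst.prodMk
        ((g.continuous_current.measurable.comp measurable_fst).inv.mul measurable_snd))
    exact h1.div measurable_snd
  have hpos : ∀ᵐ p ∂π.restrict (B ×ˢ univ), 0 < p.2 := ae_restrict_of_ae (ae_pos_of_prod_Ioi _)
  have ha0 : ∀ᵐ p ∂π.restrict (B ×ˢ univ), 0 ≤ a p := by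
    filter_upwards [hpos] with p hp using (div_pos (hl_pos _ _ hp) hp).le
  have hb0 : ∀ᵐ p ∂π.restrict (B ×ˢ univ), 0 ≤ b p := by
    filter_upwards [hpos] with p hp
    exact (div_pos (hl_pos _ _ (mul_pos (inv_pos.2 (g.current_pos _)) hp)) hp).le
  have hla : ∫⁻ p, ENNReal.ofReal (a p) ∂π.restrict (B ×ˢ univ) = levyMeasure l (B ×ˢ univ) := by
    rw [levyMeasure, withDensity_apply _ hBm']
  have hlb : ∫⁻ p, ENNReal.ofReal (b p) ∂π.restrict (B ×ˢ univ) =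
      ∫⁻ p, ENNReal.ofReal (a p) ∂π.restrict (B ×ˢ univ) := by
    rw [hπB, lintegral_prod _ ha.ennreal_ofReal.aemeasurable,
      lintegral_prod _ hb.ennreal_ofReal.aemeasurable]
    refine lintegral_congr fun x => ?_
    have hθ := inv_pos.2 (g.current_pos x)
    rw [lintegral_Ioi_zero_scale hθ fun s => ENNReal.ofReal (a (x, s))]
    refine setLIntegral_congr_fun measurableSet_Ioi fun s hs => ?_
    have hs' : s ≠ 0 := ne_of_gt hs
    have hθ' := (g.current_pos x).ne'
    rw [← ENNReal.ofReal_mul hθ.le]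
    congr 1
    simp only [a, b]
    field_simp
  have hai : IntegrableOn a (B ×ˢ univ) π :=
    ⟨ha.aestronglyMeasurable, by rw [hasFiniteIntegral_iff_ofReal ha0, hla]; exact hfin⟩
  have hbi : IntegrableOn b (B ×ˢ univ) π :=
    ⟨hb.aestronglyMeasurable, by rw [hasFiniteIntegral_iff_ofReal hb0, hlb, hla]; exact hfin⟩
  have hab : ∀ p : RSpace d × ℝ, compensator l g p.1 p.2 = a p - b p := fun p => by
    simp only [compensator, a, b, sub_div]
  have hoff : ∀ p : RSpace d × ℝ, p ∉ B ×ˢ (univ : Set ℝ) → compensator l g p.1 p.2 = 0 := by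
    intro p hp
    have hp' : p.1 ∉ B := fun h' => hp ⟨h', trivial⟩
    rw [compensator, (h p.1 hp').2.2.1, inv_one, one_mul, sub_self, zero_div]
  have hint : Integrable (fun p : RSpace d × ℝ => compensator l g p.1 p.2) π := by
    refine IntegrableOn.integrable_of_forall_notMem_eq_zero (s := B ×ˢ univ) ?_ hoff
    simp_rw [hab]
    exact hai.sub hbi
  refine ⟨hint, ?_⟩
  rw [← integral_prod (fun p : RSpace d × ℝ => compensator l g p.1 p.2) hint,
    ← setIntegral_eq_integral_of_forall_compl_eq_zero hoff]
  simp_rw [hab]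
  rw [integral_sub hai hbi, integral_eq_lintegral_of_nonneg_ae ha0 ha.aestronglyMeasurable,
    integral_eq_lintegral_of_nonneg_ae hb0 hb.aestronglyMeasurable, hlb, sub_self]

end SemidirectGroup

namespace HasPoissonFunctional

variable {d : ℕ} {m : Measure (RSpace d × ℝ)} {μ : Measure (DiscreteRadonMeasure d)}

theorem fourier_ball (hμ : HasPoissonFunctional m μ) {n : ℕ} {f : RSpace d → ℝ}
    (hfin : m (Metric.ball (0 : RSpace d) n ×ˢ univ) < ∞) (hf : Measurable f)
    (hf0 : ∀ x ∉ Metric.ball (0 : RSpace d) n, f x = 0) :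
    ∫ η, Complex.exp (Complex.I * ((∫ x, f x ∂η.1 : ℝ) : ℂ)) ∂μ =
      Complex.exp (∫ p in Metric.ball (0 : RSpace d) n ×ˢ univ,
        (Complex.exp (Complex.I * ((p.2 * f p.1 : ℝ) : ℂ)) - 1) ∂m) := by
  have h := hμ n (fun _ _ => 0) f measurable_const hf (fun _ _ _ => rfl) hf0
    (by simpa using (integrableOn_const hfin.ne : IntegrableOn (fun _ => (1 : ℝ)) _ m))
  simpa [DiscreteRadonMeasure.atomSum] using h

theorem isCompletelyRandom [IsProbabilityMeasure μ] (hμ : HasPoissonFunctional m μ)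
    (hfin : ∀ n : ℕ, m (Metric.ball (0 : RSpace d) n ×ˢ univ) < ∞) : IsCompletelyRandom μ := by
  intro N A hA hAb hdisj
  obtain ⟨r, hr⟩ := (Bornology.isBounded_iUnion.2 hAb).subset_ball (0 : RSpace d)
  obtain ⟨n, hn⟩ := exists_nat_ge r
  have hAn : ∀ i, A i ⊆ Metric.ball 0 n := fun i =>
    (subset_iUnion A i).trans (hr.trans (Metric.ball_subset_ball hn))
  have hB : MeasurableSet (Metric.ball (0 : RSpace d) n ×ˢ (univ : Set ℝ)) :=
    Metric.isOpen_ball.measurableSet.prod MeasurableSet.univ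
  let X : Fin N → DiscreteRadonMeasure d → ℝ := fun i η => η.1.real (A i)
  have hX : ∀ i, Measurable (X i) := fun i =>
    (DiscreteRadonMeasure.measurable_eval (hA i)).ennreal_toReal
  have hint : ∀ i (η : DiscreteRadonMeasure d) (c : ℝ),
      Integrable ((A i).indicator fun _ => c) η.1 := fun i η c =>
    (integrable_indicator_iff (hA i)).2
      (integrableOn_const (η.measure_lt_top_of_isBounded (hAb i)).ne)
  have hind : ∀ (c : ℝ) i, Measurable ((A i).indicator fun _ : RSpace d => c) := fun c i =>
    measurable_const.indicator (hA i)
  have hone : ∀ (c : ℝ) i, ∫ η, Complex.exp (Complex.I * ((c * X i η : ℝ) : ℂ)) ∂μ =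
      Complex.exp (∫ p in Metric.ball (0 : RSpace d) n ×ˢ univ,
        (Complex.exp (Complex.I * ((p.2 * (A i).indicator (fun _ => c) p.1 : ℝ) : ℂ)) - 1) ∂m) := by
    intro c i
    rw [← hμ.fourier_ball (hfin n) (hind c i)
      fun x hx => indicator_of_notMem (fun h => hx (hAn i h)) _]
    refine integral_congr_ae (Eventually.of_forall fun η => ?_)
    simp only
    rw [integral_indicator_const _ (hA i), smul_eq_mul, mul_comm c]
  have hind_fun : iIndepFun X μ := by
    refine (iIndepFun_iff_charFun_pi fun i => (hX i).aemeasurable).2 fun t => ?_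
    have hXm : Measurable fun η => WithLp.toLp 2 (X · η) := by fun_prop
    have hL : ∀ η : DiscreteRadonMeasure d,
        ∑ i, t i * X i η = ∫ x, ∑ i, (A i).indicator (fun _ => t i) x ∂η.1 := by
      intro η
      rw [integral_finsetSum _ fun i _ => hint i η _]
      refine Finset.sum_congr rfl fun i _ => ?_
      rw [integral_indicator_const _ (hA i), smul_eq_mul, mul_comm]
    have hLHS : charFun (μ.map fun η => WithLp.toLp 2 (X · η)) t =
        ∫ η, Complex.exp (Complex.I *
          ((∫ x, ∑ i, (A i).indicator (fun _ => t i) x ∂η.1 : ℝ) : ℂ)) ∂μ := by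
      rw [charFun_apply, integral_map hXm.aemeasurable (by fun_prop)]
      refine integral_congr_ae (Eventually.of_forall fun η => ?_)
      simp only
      rw [← hL η, mul_comm]
      congr 3
    have hRHS : ∀ i, charFun (μ.map (X i)) (t i) =
        ∫ η, Complex.exp (Complex.I * ((t i * X i η : ℝ) : ℂ)) ∂μ := by
      intro i
      rw [charFun_apply_real, integral_map (hX i).aemeasurable (by fun_prop)]
      refine integral_congr_ae (Eventually.of_forall fun η => ?_)
      simp only
      push_cast
      rw [mul_comm]
    have hpt : ∀ p : RSpace d × ℝ,
        Complex.exp (Complex.I *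
          ((p.2 * ∑ i, (A i).indicator (fun _ => t i) p.1 : ℝ) : ℂ)) - 1 =
        ∑ i, (Complex.exp (Complex.I *
          ((p.2 * (A i).indicator (fun _ => t i) p.1 : ℝ) : ℂ)) - 1) := by
      intro p
      by_cases hp : ∃ i, p.1 ∈ A i
      · obtain ⟨i, hi⟩ := hp
        have hj : ∀ j, j ≠ i → p.1 ∉ A j := fun j hj hpj =>
          (Set.disjoint_left.1 (hdisj hj)) hpj hi
        rw [Finset.sum_eq_single i (fun j _ hji => indicator_of_notMem (hj j hji) _) (by simp),
          Finset.sum_eq_single i _ (by simp)]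
        intro j _ hji
        rw [indicator_of_notMem (hj j hji)]
        simp
      · rw [not_exists] at hp
        simp [indicator_of_notMem (hp _)]
    have hbd : ∀ i, IntegrableOn (fun p : RSpace d × ℝ => Complex.exp (Complex.I *
          ((p.2 * (A i).indicator (fun _ => t i) p.1 : ℝ) : ℂ)) - 1)
        (Metric.ball (0 : RSpace d) n ×ˢ univ) m := by
      intro i
      have h1 : Measurable fun p : RSpace d × ℝ => p.2 * (A i).indicator (fun _ => t i) p.1 :=
        measurable_snd.mul ((hind (t i) i).comp measurable_fst)
      refine Integrable.sub (Integrable.mono' (g := fun _ => (1 : ℝ))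
        (integrableOn_const (hfin n).ne) ?_ (Eventually.of_forall fun p => ?_))
        (integrableOn_const (hfin n).ne)
      · exact (by fun_prop : Measurable fun p : RSpace d × ℝ => Complex.exp (Complex.I *
          ((p.2 * (A i).indicator (fun _ => t i) p.1 : ℝ) : ℂ))).aestronglyMeasurable
      · rw [Complex.norm_exp_I_mul_ofReal]
    rw [hLHS, hμ.fourier_ball (hfin n) (Finset.measurable_fun_sum _ fun i _ => hind (t i) i)
      fun x hx => Finset.sum_eq_zero fun i _ => indicator_of_notMem (fun h => hx (hAn i h)) _]
    simp_rw [hRHS, hone, hpt]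
    rw [integral_finsetSum _ fun i _ => hbd i, Complex.exp_sum]
  have := hind_fun.comp (fun _ => ENNReal.ofReal) fun _ => ENNReal.measurable_ofReal
  convert this using 2 with i
  funext η
  exact (ENNReal.ofReal_toReal (η.measure_lt_top_of_isBounded (hAb i)).ne).symm

theorem isCompletelyRandomWithLevyMeasure [IsProbabilityMeasure μ]
    (hμ : HasPoissonFunctional m μ)
    (hfin : ∀ n : ℕ, m (Metric.ball (0 : RSpace d) n ×ˢ univ) < ∞) :
    IsCompletelyRandomWithLevyMeasure m μ where
  isProbabilityMeasure := inferInstance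
  isCompletelyRandom := hμ.isCompletelyRandom hfin
  fourier f hf hfc := by
    obtain ⟨r, hr⟩ := hfc.isCompact.isBounded.subset_ball (0 : RSpace d)
    obtain ⟨n, hn⟩ := exists_nat_ge r
    have hf0 : ∀ x ∉ Metric.ball (0 : RSpace d) n, f x = 0 := fun x hx =>
      image_eq_zero_of_notMem_tsupport fun h => hx (Metric.ball_subset_ball hn (hr h))
    rw [hμ.fourier_ball (hfin n) hf.measurable hf0,
      setIntegral_eq_integral_of_forall_compl_eq_zero]
    intro p hp
    rw [hf0 p.1 fun h => hp ⟨h, trivial⟩]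
    simp

end HasPoissonFunctional

theorem IsCompletelyRandomWithLevyMeasure.unique {d : ℕ} {m : Measure (RSpace d × ℝ)}
    {μ ν : Measure (DiscreteRadonMeasure d)} (hμ : IsCompletelyRandomWithLevyMeasure m μ)
    (hν : IsCompletelyRandomWithLevyMeasure m ν) : μ = ν := by
  have := hμ.isProbabilityMeasure
  have := hν.isProbabilityMeasure
  exact DiscreteRadonMeasure.ext_of_fourier fun f hf hfc =>
    (hμ.fourier f hf hfc).trans (hν.fourier f hf hfc).symm

namespace SemidirectGroup

variable {d : ℕ} (g : SemidirectGroup d)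

theorem coe_smul (η : DiscreteRadonMeasure d) : (g • η).1 = g.actMeasure η.1 := rfl

theorem measurable_smul_discreteRadonMeasure :
    Measurable fun η : DiscreteRadonMeasure d => g • η := by
  refine Measurable.subtype_mk (f := fun η : DiscreteRadonMeasure d => g.actMeasure η.1) ?_
  refine Measure.measurable_of_measurable_coe _ fun A hA => ?_
  have hA' : MeasurableSet (g.diffeo ⁻¹' A) := g.measurable_diffeo hA
  simp_rw [actMeasure_apply g _ hA, ← lintegral_indicator hA']
  exact (Measure.measurable_lintegral
    ((g.measurable_ofReal_current.comp g.measurable_diffeo).indicator hA')).comp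
    measurable_subtype_coe

theorem integral_smul_discreteRadonMeasure (η : DiscreteRadonMeasure d) {f : RSpace d → ℝ}
    (hf : Continuous f) :
    ∫ x, f x ∂(g • η).1 = ∫ x, g.current (g.diffeo x) * f (g.diffeo x) ∂η.1 := by
  rw [coe_smul, actMeasure, integral_withDensity_eq_integral_toReal_smul
    g.measurable_ofReal_current (Eventually.of_forall fun _ => ENNReal.ofReal_lt_top),
    integral_map g.measurable_diffeo.aemeasurable]
  · simp_rw [ENNReal.toReal_ofReal (g.current_pos _).le, smul_eq_mul]
  · simp_rw [ENNReal.toReal_ofReal (g.current_pos _).le, smul_eq_mul]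
    exact (g.continuous_current.mul hf).aestronglyMeasurable

variable {g} {l : RSpace d → ℝ → ℝ} {μ : Measure (DiscreteRadonMeasure d)}

/-- The image of the Poisson random discrete measure has the product of the densities of the marked
points as its density. -/
theorem TrivialOutside.map_smul_eq_withDensity {n : ℕ} (hg : g.TrivialOutside n)
    (hl_meas : Measurable (Function.uncurry l))
    (hl_pos : ∀ x : RSpace d, ∀ s : ℝ, 0 < s → 0 < l x s)
    (hfin : ∀ n : ℕ, levyMeasure l (Metric.ball (0 : RSpace d) n ×ˢ univ) < ∞)
    [IsProbabilityMeasure μ] (hμ : HasPoissonFunctional (levyMeasure l) μ) :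
    μ.map (fun η => g • η) = μ.withDensity fun η => ENNReal.ofReal
      (Real.exp (DiscreteRadonMeasure.atomSum
        (fun x s => Real.log (g.markedDensity l x s)) η)) := by
  set h : RSpace d → ℝ → ℝ := fun x s => Real.log (g.markedDensity l x s)
  have hρm : Measurable fun p : RSpace d × ℝ => g.markedDensity l p.1 p.2 :=
    g.measurable_markedDensity hl_meas
  have hhm : Measurable (Function.uncurry h) := hρm.log
  have hSm : Measurable (DiscreteRadonMeasure.atomSum h) :=
    DiscreteRadonMeasure.measurable_atomSum hhm
  have hexp : ∀ᵐ p ∂levyMeasure l, Real.exp (h p.1 p.2) = g.markedDensity l p.1 p.2 := by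
    filter_upwards [ae_pos_levyMeasure l] with p hp
    exact Real.exp_log (g.markedDensity_pos hl_pos p.1 hp)
  have key : ∀ N, n ≤ N → ∀ f : RSpace d → ℝ, Measurable f →
      (∀ x ∉ Metric.ball (0 : RSpace d) N, f x = 0) →
      ∫ η, Complex.exp ((DiscreteRadonMeasure.atomSum h η : ℝ) +
        Complex.I * ((∫ x, f x ∂η.1 : ℝ) : ℂ)) ∂μ =
      Complex.exp (∫ p, g.markedDensity l p.1 p.2 •
        (Complex.exp (Complex.I * ((p.2 * f p.1 : ℝ) : ℂ)) - 1) ∂levyMeasure l) := by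
    intro N hN f hf hf0
    have hgN := hg.mono hN
    obtain ⟨hρi, hρint⟩ := hgN.integrableOn_markedDensity hl_meas hl_pos (hfin N)
    have hei : IntegrableOn (fun p : RSpace d × ℝ => Real.exp (h p.1 p.2))
        (Metric.ball (0 : RSpace d) N ×ˢ univ) (levyMeasure l) :=
      hρi.congr_fun_ae (ae_restrict_of_ae (hexp.mono fun p hp => hp.symm))
    have hvm : Measurable fun p : RSpace d × ℝ =>
        Complex.exp (Complex.I * ((p.2 * f p.1 : ℝ) : ℂ)) := by
      have h2 : Measurable fun p : RSpace d × ℝ => p.2 * f p.1 :=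
        measurable_snd.mul (hf.comp measurable_fst)
      fun_prop
    have hρv : IntegrableOn (fun p : RSpace d × ℝ => g.markedDensity l p.1 p.2 •
        Complex.exp (Complex.I * ((p.2 * f p.1 : ℝ) : ℂ)))
        (Metric.ball (0 : RSpace d) N ×ˢ univ) (levyMeasure l) := by
      refine Integrable.mono' hρi.norm (hρm.smul hvm).aestronglyMeasurable
        (Eventually.of_forall fun p => ?_)
      rw [norm_smul, Complex.norm_exp_I_mul_ofReal, mul_one]
    rw [hμ N h f hhm hf (fun x hx s => hgN.log_markedDensity_eq_zero hx s) hf0 hei]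
    congr 1
    have hoff : ∀ p : RSpace d × ℝ, p ∉ Metric.ball (0 : RSpace d) N ×ˢ (univ : Set ℝ) →
        g.markedDensity l p.1 p.2 •
          (Complex.exp (Complex.I * ((p.2 * f p.1 : ℝ) : ℂ)) - 1) = 0 := by
      intro p hp
      rw [hf0 p.1 fun h' => hp ⟨h', trivial⟩]
      simp
    rw [← setIntegral_eq_integral_of_forall_compl_eq_zero hoff]
    have h1 : ∀ᵐ p ∂(levyMeasure l).restrict (Metric.ball (0 : RSpace d) N ×ˢ univ),
        Complex.exp ((h p.1 p.2 : ℝ) + Complex.I * ((p.2 * f p.1 : ℝ) : ℂ)) - 1 =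
        g.markedDensity l p.1 p.2 • Complex.exp (Complex.I * ((p.2 * f p.1 : ℝ) : ℂ)) - 1 := by
      filter_upwards [ae_restrict_of_ae hexp] with p hp
      rw [Complex.exp_add, ← Complex.ofReal_exp, hp, Complex.real_smul]
    rw [integral_congr_ae h1, integral_sub hρv (integrableOn_const (hfin N).ne)]
    simp_rw [smul_sub]
    have hρ1 : IntegrableOn (fun p : RSpace d × ℝ => g.markedDensity l p.1 p.2 • (1 : ℂ))
        (Metric.ball (0 : RSpace d) N ×ˢ univ) (levyMeasure l) := hρi.smul_const _
    rw [integral_sub hρv hρ1, integral_smul_const, hρint, setIntegral_const]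
  have hmeasexp : ∀ f : RSpace d → ℝ, Measurable f → Measurable fun η : DiscreteRadonMeasure d =>
      Complex.exp ((DiscreteRadonMeasure.atomSum h η : ℝ) +
        Complex.I * ((∫ x, f x ∂η.1 : ℝ) : ℂ)) := by
    intro f hf
    have h2 := DiscreteRadonMeasure.measurable_integral hf
    fun_prop
  have hSint : Integrable (fun η => Real.exp (DiscreteRadonMeasure.atomSum h η)) μ := by
    have h0 := key n le_rfl (fun _ => 0) measurable_const fun _ _ => rfl
    have h1 : Integrable (fun η => Complex.exp ((DiscreteRadonMeasure.atomSum h η : ℝ) +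
        Complex.I * ((∫ x, (0 : ℝ) ∂η.1 : ℝ) : ℂ))) μ := by
      by_contra hne
      rw [integral_undef hne] at h0
      exact Complex.exp_ne_zero _ h0.symm
    refine h1.norm.congr (Eventually.of_forall fun η => ?_)
    simp [Complex.norm_exp]
  have hSm' : Measurable fun η => ENNReal.ofReal (Real.exp (DiscreteRadonMeasure.atomSum h η)) :=
    hSm.exp.ennreal_ofReal
  have hfinD : IsFiniteMeasure (μ.withDensity fun η => ENNReal.ofReal
      (Real.exp (DiscreteRadonMeasure.atomSum h η))) :=
    isFiniteMeasure_withDensity_ofReal hSint.2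
  have hact := g.measurable_smul_discreteRadonMeasure
  have := Measure.isProbabilityMeasure_map (μ := μ) hact.aemeasurable
  refine DiscreteRadonMeasure.ext_of_fourier fun f hf hfc => ?_
  obtain ⟨r, hr⟩ := hfc.isCompact.isBounded.subset_ball (0 : RSpace d)
  obtain ⟨k, hk⟩ := exists_nat_ge r
  set N := max n k
  have hf0 : ∀ x ∉ Metric.ball (0 : RSpace d) N, f x = 0 := fun x hx =>
    image_eq_zero_of_notMem_tsupport fun h' => hx (Metric.ball_subset_ball
      (hk.trans (by exact_mod_cast le_max_right n k)) (hr h'))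
  have hgN := hg.mono (le_max_left n k)
  have hvm : Measurable fun p : RSpace d × ℝ =>
      Complex.exp (Complex.I * ((p.2 * f p.1 : ℝ) : ℂ)) - 1 := by
    have h2 : Measurable fun p : RSpace d × ℝ => p.2 * f p.1 :=
      measurable_snd.mul (hf.measurable.comp measurable_fst)
    fun_prop
  have hfourier := hμ.fourier_ball (n := N) (hfin N)
    (f := fun x => g.current (g.diffeo x) * f (g.diffeo x))
    (((g.continuous_current.mul hf).comp g.continuous_diffeo).measurable) fun x hx => by
      rw [hf0 _ fun h' => hx ((hgN.diffeo_mem_ball_iff x).1 h'), mul_zero]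
  rw [integral_map hact.aemeasurable]
  swap
  · have h2 := DiscreteRadonMeasure.measurable_integral hf.measurable
    exact (by fun_prop : Measurable fun η : DiscreteRadonMeasure d =>
      Complex.exp (Complex.I * ((∫ x, f x ∂η.1 : ℝ) : ℂ))).aestronglyMeasurable
  simp_rw [integral_smul_discreteRadonMeasure g _ hf]
  rw [hfourier, integral_withDensity_eq_integral_toReal_smul hSm'
    (Eventually.of_forall fun _ => ENNReal.ofReal_lt_top)]
  have hR : ∀ η : DiscreteRadonMeasure d,
      (ENNReal.ofReal (Real.exp (DiscreteRadonMeasure.atomSum h η))).toReal •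
        Complex.exp (Complex.I * ((∫ x, f x ∂η.1 : ℝ) : ℂ)) =
      Complex.exp ((DiscreteRadonMeasure.atomSum h η : ℝ) +
        Complex.I * ((∫ x, f x ∂η.1 : ℝ) : ℂ)) := by
    intro η
    rw [ENNReal.toReal_ofReal (Real.exp_pos _).le, Complex.exp_add, Complex.real_smul,
      Complex.ofReal_exp]
  simp_rw [hR]
  rw [key N (le_max_left n k) f hf.measurable hf0]
  congr 1
  rw [setIntegral_eq_integral_of_forall_compl_eq_zero]
  swap
  · intro p hp
    rw [hf0 (g.diffeo p.1) fun h' => hp ⟨(hgN.diffeo_mem_ball_iff p.1).1 h', trivial⟩]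
    simp
  have hmapint := integral_map (μ := levyMeasure l) g.measurable_actMarked.aemeasurable
    (f := fun p : RSpace d × ℝ => Complex.exp (Complex.I * ((p.2 * f p.1 : ℝ) : ℂ)) - 1)
    hvm.aestronglyMeasurable
  rw [g.map_actMarked_levyMeasure hl_meas hl_pos, integral_withDensity_eq_integral_toReal_smul
    hρm.ennreal_ofReal (Eventually.of_forall fun _ => ENNReal.ofReal_lt_top)] at hmapint
  have hL : ∫ p : RSpace d × ℝ, (Complex.exp (Complex.I * ((p.2 *
      (g.current (g.diffeo p.1) * f (g.diffeo p.1)) : ℝ) : ℂ)) - 1) ∂levyMeasure l =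
      ∫ p, (Complex.exp (Complex.I * (((g.actMarked p).2 * f (g.actMarked p).1 : ℝ) : ℂ)) - 1)
        ∂levyMeasure l := by
    refine integral_congr_ae (Eventually.of_forall fun p => ?_)
    simp only [actMarked]
    congr 4
    ring
  rw [hL, ← hmapint]
  refine integral_congr_ae ?_
  filter_upwards [ae_pos_levyMeasure l] with p hp
  rw [ENNReal.toReal_ofReal (g.markedDensity_pos hl_pos p.1 hp).le]

theorem TrivialOutside.density_of_mem_locallyFiniteAtoms {n : ℕ} (hg : g.TrivialOutside n)
    (hl_meas : Measurable (Function.uncurry l))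
    (hl_pos : ∀ x : RSpace d, ∀ s : ℝ, 0 < s → 0 < l x s)
    (hfin : levyMeasure l (Metric.ball (0 : RSpace d) n ×ˢ univ) < ∞)
    {η : DiscreteRadonMeasure d} (hη : η ∈ DiscreteRadonMeasure.locallyFiniteAtoms d) :
    (Multipliable fun x : η.atoms => atomFactor l g η x) ∧
      Integrable (logIntegrand l g η) η.1 ∧
      semidirectDensity l g η = Real.exp (DiscreteRadonMeasure.atomSum
        (fun x s => Real.log (g.markedDensity l x s)) η) := by
  have hF : ∀ x ∈ η.atoms, x ∉ Metric.ball (0 : RSpace d) n → atomFactor l g η x = 1 := by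
    intro x hx hxn
    obtain ⟨-, h2, h3, h4⟩ := hg x hxn
    rw [atomFactor, h2, h3, h4, inv_one, one_mul,
      div_self (hl_pos x _ (DiscreteRadonMeasure.weight_pos hx)).ne', one_mul]
  obtain ⟨hmult, hprod⟩ := DiscreteRadonMeasure.multipliable_and_tprod_eq_prod hη hF
  obtain ⟨hint, hsum⟩ := DiscreteRadonMeasure.integrable_and_atomSum_eq_sum hη (n := n)
    (h := fun x s => Real.log (l x ((g.current x)⁻¹ * s) / l x s)) fun x hx s hs => by
      rw [(hg x hx).2.2.1, inv_one, one_mul, div_self (hl_pos x s hs).ne', Real.log_one]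
  obtain ⟨-, hsum'⟩ := DiscreteRadonMeasure.integrable_and_atomSum_eq_sum hη (n := n)
    (h := fun x s => Real.log (g.markedDensity l x s)) fun x hx s _ =>
      hg.log_markedDensity_eq_zero hx s
  refine ⟨hmult, hint, ?_⟩
  have hlog : ∫ x, logIntegrand l g η x ∂η.1 = DiscreteRadonMeasure.atomSum
      (fun x s => Real.log (l x ((g.current x)⁻¹ * s) / l x s)) η := rfl
  rw [semidirectDensity, (hg.integrable_compensator hl_meas hl_pos hfin).2, add_zero, hlog, hprod,
    hsum, hsum', Real.exp_sum, Real.exp_sum, ← Finset.prod_mul_distrib]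
  refine Finset.prod_congr rfl fun x hx => ?_
  have hw := DiscreteRadonMeasure.weight_pos ((Finite.mem_toFinset _).1 hx).1
  have hw' := mul_pos (inv_pos.2 (g.current_pos x)) hw
  have h1 := hl_pos x _ hw
  have h2 := hl_pos x _ hw'
  rw [Real.exp_log (g.markedDensity_pos hl_pos x hw), Real.exp_log (div_pos h2 h1), atomFactor,
    markedDensity]
  generalize (g.current x)⁻¹ * η.weight x = t at h2 ⊢
  field_simp

end SemidirectGroup

theorem theorem5p2 (d : ℕ) (hd : 1 ≤ d) (l : RSpace d → ℝ → ℝ)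
    (hl_meas : Measurable (Function.uncurry l))
    (hl_pos : ∀ x : RSpace d, ∀ s : ℝ, 0 < s → 0 < l x s)
    (hl_int : ∀ A : Set (RSpace d), MeasurableSet A → Bornology.IsBounded A →
      ∫⁻ p in A ×ˢ Ioi (0 : ℝ), ENNReal.ofReal (l p.1 p.2 * min p.2⁻¹ 1) < ∞)
    (hl_fin : ∀ A : Set (RSpace d), MeasurableSet A → Bornology.IsBounded A →
      levyMeasure l (A ×ˢ Ioi (0 : ℝ)) < ∞) :
    (∃! μ : Measure (DiscreteRadonMeasure d),
      IsCompletelyRandomWithLevyMeasure (levyMeasure l) μ) ∧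
    ∀ μ : Measure (DiscreteRadonMeasure d),
      IsCompletelyRandomWithLevyMeasure (levyMeasure l) μ →
      IsQuasiInvariant (SemidirectGroup d) μ ∧
      ∀ g : SemidirectGroup d,
        (∀ᵐ η ∂μ, Multipliable fun x : η.atoms => atomFactor l g η x) ∧
        (∀ᵐ η ∂μ, Integrable (logIntegrand l g η) η.1) ∧
        Integrable (fun p : RSpace d × ℝ => compensator l g p.1 p.2)
          (volume.prod (volume.restrict (Ioi (0 : ℝ)))) ∧
        (μ.map fun η => g • η).rnDeriv μ =ᵐ[μ]
          fun η => ENNReal.ofReal (semidirectDensity l g η) := by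
  have hfin : ∀ n : ℕ, levyMeasure l (Metric.ball (0 : RSpace d) n ×ˢ univ) < ∞ := fun n => by
    rw [levyMeasure_prod_univ]
    exact hl_fin _ Metric.isOpen_ball.measurableSet Metric.isBounded_ball
  obtain ⟨μ₀, hμ₀, hatoms₀, hpoisson₀⟩ := exists_hasPoissonFunctional (m := levyMeasure l)
    (fun k => by
      rw [levyMeasure_prod_univ]
      exact hl_fin _ (measurableSet_annulus d k) (isBounded_annulus d k))
    (ae_pos_levyMeasure l) (levyMeasure_fst_preimage_singleton hd)
  have hcr₀ := hpoisson₀.isCompletelyRandomWithLevyMeasure hfin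
  refine ⟨⟨μ₀, hcr₀, fun ν hν => hν.unique hcr₀⟩, fun μ hμ => ?_⟩
  obtain rfl : μ = μ₀ := hμ.unique hcr₀
  have hS : ∀ g : SemidirectGroup d, Measurable fun η : DiscreteRadonMeasure d =>
      ENNReal.ofReal (Real.exp (DiscreteRadonMeasure.atomSum
        (fun x s => Real.log (g.markedDensity l x s)) η)) := fun g =>
    (DiscreteRadonMeasure.measurable_atomSum
      (g.measurable_markedDensity hl_meas).log).exp.ennreal_ofReal
  refine ⟨fun g => ⟨g.measurable_smul_discreteRadonMeasure, ?_⟩, fun g => ?_⟩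
  · obtain ⟨n, hg⟩ := g.exists_trivialOutside
    rw [hg.map_smul_eq_withDensity hl_meas hl_pos hfin hpoisson₀]
    exact ⟨withDensity_absolutelyContinuous _ _, withDensity_absolutelyContinuous'
      (hS g).aemeasurable (Eventually.of_forall fun η => by simp [Real.exp_pos])⟩
  · obtain ⟨n, hg⟩ := g.exists_trivialOutside
    have hdens := hatoms₀.mono fun η hη =>
      hg.density_of_mem_locallyFiniteAtoms hl_meas hl_pos (hfin n) hη
    refine ⟨hdens.mono fun η hη => hη.1, hdens.mono fun η hη => hη.2.1,
      (hg.integrable_compensator hl_meas hl_pos (hfin n)).1, ?_⟩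
    rw [hg.map_smul_eq_withDensity hl_meas hl_pos hfin hpoisson₀]
    filter_upwards [Measure.rnDeriv_withDensity μ (hS g), hdens] with η h1 h2
    rw [h1, h2.2.2]
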